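/- Let $c>0$, $t>0$ and let $n\ge 1$, $d\ge 2$ be integers. For $a>0$, a random flight in $\mathbb R^d$ with speed $c$, exactly $n$ changes of direction in $[0,t]$ and Dirichlet parameter $a$ has position at time $t$ $$c\sum_{j=1}^{n+1}\tau_j\,\theta_j ,\qquad \tau_{n+1}=t-\sum_{j=1}^n\tau_j ,$$ where $\theta_1,\dots,\theta_{n+1}$ are independent and uniformly distributed on the unit sphere of $\mathbb R^d$, and, independently of them, $(\tau_1,\dots,\tau_n)$ has the density $$\frac{\Gamma((n+1)a)}{\Gamma(a)^{n+1}}\,\frac{1}{t^{(n+1)a-1}}\prod_{j=1}^{n+1}\tau_j^{a-1}\qquad\text{on } \{\tau_1,\dots,\tau_{n+1}>0\}.$$ Write $\mathbf X_d(t)$ for this position when $a=d-1$, $d\ge 2$, and $\mathbf Y_d(t)$ when $a=\frac d2-1$, $d\ge 3$. Then for $1\le m\le d$ the projections of $\mathbf X_d(t)$ and $\mathbf Y_d(t)$ onto the first $m$ coordinates have, respectively, the densities $$f^d_{\mathbf X_m}(\mathbf x_m,t;n)=\frac{\Gamma\left(\frac{n+1}2(d-1)+\frac12\right)}{\Gamma\left(\frac{n+1}2(d-1)+\frac{1-m}2\right)}\,\frac{(c^2t^2-\|\mathbf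 x_m\|^2)^{\frac{n+1}2(d-1)-\frac{m+1}2}}{\pi^{m/2}(ct)^{(n+1)(d-1)-1}},\qquad \|\mathbf x_m\|<ct,$$ $$f^d_{\mathbf Y_m}(\mathbf y_m,t;n)=\frac{\Gamma\left((n+1)(\frac d2-1)+1\right)}{\Gamma\left((n+1)(\frac d2-1)+1-\frac m2\right)}\,\frac{(c^2t^2-\|\mathbf y_m\|^2)^{(n+1)(\frac d2-1)-\frac m2}}{\pi^{m/2}(ct)^{2(n+1)(\frac d2-1)}},\qquad \|\mathbf y_m\|<ct,$$ and zero elsewhere. For $m=d$ these coincide with the densities of $\mathbf X_d(t)$ and $\mathbf Y_d(t)$ themselves, $$\frac{\Gamma\left(\frac{n+1}2(d-1)+\frac12\right)}{\Gamma\left(\frac n2(d-1)\right)}\,\frac{(c^2t^2-\|\mathbf x_d\|^2)^{\frac n2(d-1)-1}}{\pi^{d/2}(ct)^{(n+1)(d-1)-1}},\qquad \frac{\Gamma\left((n+1)(\frac d2-1)+1\right)}{\Gamma\left(n(\frac d2-1)\right)}\,\frac{(c^2t^2-\|\mathbf y_d\|^2)^{n(\frac d2-1)-1}}{\pi^{d/2}(ct)^{2(n+1)(\frac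 d2-1)}} .$$ For $m=1$ they are symmetric Beta laws on $(-ct,ct)$: with $X_1(t)$, $Y_1(t)$ the first coordinates, $\frac12\left(1+\frac{X_1(t)}{ct}\right)\sim\mathrm{Beta}(\alpha,\alpha)$ with $\alpha=\frac{n+1}2(d-1)$, and $\frac12\left(1+\frac{Y_1(t)}{ct}\right)\sim\mathrm{Beta}(\beta,\beta)$ with $\beta=(n+1)\left(\frac d2-1\right)+\frac12$. -/

import Mathlib

open MeasureTheory ProbabilityTheory

noncomputable section

namespace RandomFlight

/-- The uniform distribution on the unit sphere of `ℝ^d`: surface measure, normalized. -/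
def uniformSphere (d : ℕ) :
    Measure (Metric.sphere (0 : EuclideanSpace ℝ (Fin d)) 1) :=
  ((volume : Measure (EuclideanSpace ℝ (Fin d))).toSphere Set.univ)⁻¹ •
    (volume : Measure (EuclideanSpace ℝ (Fin d))).toSphere

/-- The `n + 1` durations `τ₁, …, τₙ, τₙ₊₁` with `τₙ₊₁ = t - (τ₁ + ⋯ + τₙ)`. -/
def durations {n : ℕ} (t : ℝ) (s : Fin n → ℝ) : Fin (n + 1) → ℝ :=
  Fin.snoc (α := fun _ => ℝ) s (t - ∑ j, s j)

/-- Density on `ℝ^n` of the Dirichlet distribution with all `n + 1` parameters equal to `a`,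
rescaled to total length `t`; it vanishes off the open simplex `{all n + 1 durations > 0}`. -/
def dirichletDensity (n : ℕ) (a t : ℝ) (s : Fin n → ℝ) : ℝ :=
  open Classical in
  if ∀ j, 0 < durations t s j then
    Real.Gamma ((n + 1) * a) / Real.Gamma a ^ (n + 1) * (1 / t ^ ((n + 1) * a - 1)) *
      ∏ j, durations t s j ^ (a - 1)
  else 0

/-- The random data of a flight in `ℝ^d` over `[0, t]` with exactly `n` changes of direction:
the first `n` durations `τ` have the rescaled Dirichlet law with parameters `a`, the `n + 1`
directions `θ` are independent and uniform on the unit sphere, and `τ` and `θ` are independent. -/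
structure IsFlightData {Ω : Type*} [MeasurableSpace Ω] (P : Measure Ω) (d n : ℕ) (a t : ℝ)
    (τ : Ω → Fin n → ℝ)
    (θ : Fin (n + 1) → Ω → Metric.sphere (0 : EuclideanSpace ℝ (Fin d)) 1) : Prop where
  law_times : HasLaw τ
    ((volume : Measure (Fin n → ℝ)).withDensity
      fun s => ENNReal.ofReal (dirichletDensity n a t s)) P
  law_directions : ∀ j, HasLaw (θ j) (uniformSphere d) P
  indep_directions : iIndepFun θ P
  indep_times_directions : IndepFun τ (fun ω j => θ j ω) P

/-- Position at time `t` of the flight with speed `c`: `c * ∑ⱼ τⱼ θⱼ`, sum over `n + 1` steps. -/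
def position {Ω : Type*} {d n : ℕ} (c t : ℝ) (τ : Ω → Fin n → ℝ)
    (θ : Fin (n + 1) → Ω → Metric.sphere (0 : EuclideanSpace ℝ (Fin d)) 1) (ω : Ω) :
    EuclideanSpace ℝ (Fin d) :=
  c • ∑ j, durations t (τ ω) j • (θ j ω : EuclideanSpace ℝ (Fin d))

/-- Projection of `ℝ^d` onto the first `m` coordinates. -/
def proj {m d : ℕ} (h : m ≤ d) (x : EuclideanSpace ℝ (Fin d)) : EuclideanSpace ℝ (Fin m) :=
  WithLp.toLp 2 fun i => x (Fin.castLE h i)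

/-- Density on `ℝ^m` of the projection of the flight with Dirichlet parameters `d - 1`. -/
def margX (d n m : ℕ) (c t : ℝ) (x : EuclideanSpace ℝ (Fin m)) : ℝ :=
  open Classical in
  if ‖x‖ < c * t then
    Real.Gamma (((n : ℝ) + 1) / 2 * (d - 1) + 1 / 2) /
        Real.Gamma (((n : ℝ) + 1) / 2 * (d - 1) + (1 - m) / 2) *
      ((c ^ 2 * t ^ 2 - ‖x‖ ^ 2) ^ (((n : ℝ) + 1) / 2 * (d - 1) - (m + 1) / 2) /
        (Real.pi ^ ((m : ℝ) / 2) * (c * t) ^ (((n : ℝ) + 1) * (d - 1) - 1)))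
  else 0

/-- Density on `ℝ^m` of the projection of the flight with Dirichlet parameters `d / 2 - 1`. -/
def margY (d n m : ℕ) (c t : ℝ) (y : EuclideanSpace ℝ (Fin m)) : ℝ :=
  open Classical in
  if ‖y‖ < c * t then
    Real.Gamma (((n : ℝ) + 1) * (d / 2 - 1) + 1) /
        Real.Gamma (((n : ℝ) + 1) * (d / 2 - 1) + 1 - m / 2) *
      ((c ^ 2 * t ^ 2 - ‖y‖ ^ 2) ^ (((n : ℝ) + 1) * (d / 2 - 1) - m / 2) /
        (Real.pi ^ ((m : ℝ) / 2) * (c * t) ^ (2 * ((n : ℝ) + 1) * (d / 2 - 1))))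
  else 0

/-- Density on `ℝ^d` of the position of the flight with Dirichlet parameters `d - 1`. -/
def fullX (d n : ℕ) (c t : ℝ) (x : EuclideanSpace ℝ (Fin d)) : ℝ :=
  open Classical in
  if ‖x‖ < c * t then
    Real.Gamma (((n : ℝ) + 1) / 2 * (d - 1) + 1 / 2) / Real.Gamma ((n : ℝ) / 2 * (d - 1)) *
      ((c ^ 2 * t ^ 2 - ‖x‖ ^ 2) ^ ((n : ℝ) / 2 * (d - 1) - 1) /
        (Real.pi ^ ((d : ℝ) / 2) * (c * t) ^ (((n : ℝ) + 1) * (d - 1) - 1)))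
  else 0

/-- Density on `ℝ^d` of the position of the flight with Dirichlet parameters `d / 2 - 1`. -/
def fullY (d n : ℕ) (c t : ℝ) (y : EuclideanSpace ℝ (Fin d)) : ℝ :=
  open Classical in
  if ‖y‖ < c * t then
    Real.Gamma (((n : ℝ) + 1) * (d / 2 - 1) + 1) / Real.Gamma ((n : ℝ) * (d / 2 - 1)) *
      ((c ^ 2 * t ^ 2 - ‖y‖ ^ 2) ^ ((n : ℝ) * (d / 2 - 1) - 1) /
        (Real.pi ^ ((d : ℝ) / 2) * (c * t) ^ (2 * ((n : ℝ) + 1) * (d / 2 - 1))))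
  else 0

end RandomFlight

end

/-!
The proof is by moments. Every measure in the theorem is carried by a ball, so it is determined by
the moments of its one-dimensional projections `⟨ξ, ·⟩` (`ext_of_moments`), the characteristic
function being a power series in them. Projecting to the first `m` coordinates only restricts `ξ`.

For `θ` uniform on the sphere of `ℝ^d`, `⟨ξ, θ⟩` has moments `‖ξ‖ ^ k * symmMoment (d / 2) k`
(`integral_uniformSphere_inner_pow`), and a vector with density proportional to
`(R² - ‖x‖²) ^ (q - m/2 - 1)` on the ball of radius `R` in `ℝ^m` has moments
`(R * ‖ξ‖) ^ k * symmMoment q k`, whatever `m` is (`integral_inner_pow_mul_ballDensity`). The mixed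
moments of the Dirichlet law are quotients of Gamma functions (`integral_dirichletLaw_prod_pow`).
Expanding `⟨ξ, c ∑ τⱼ θⱼ⟩ ^ k` by the multinomial theorem, independence gives, with
`A = (n + 1) * a`,

`E ⟨ξ, X⟩ ^ k = (c t ‖ξ‖) ^ k * (k! Γ(A) / Γ(A + k)) * [z ^ k] F_a(z) ^ (n + 1)`,

where `F_a(z)` is the formal expectation of `(1 - z U) ^ (-a)` for a one-dimensional projection `U`
of the uniform law (`momentSeries`). The theorem therefore amounts to the semigroup law
`F_a ^ (n + 1) = F_A`, in which the law of `U` varies with the parameter. It holds in two cases: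
* if `d / 2 = (a + 1) / 2`, i.e. `a = d - 1`, then `F_a = (1 - z²) ^ (-a/2)`;
* if `d / 2 = a + 1`, i.e. `a = d / 2 - 1`, then `F_a = ((1 + √(1 - z²)) / 2) ^ (-a)`.
Both are proved without analysis of power series (`sum_antidiagonal_eval_mul_eval`): the
coefficients are polynomials in `a` that satisfy a difference equation in `a`.

The case `m = 1` is turned into a Beta law by an affine change of variable and the duplication
formula for the Gamma function.
-/

noncomputable section

namespace RandomFlight

/-! ### One-dimensional integrals and polar coordinates -/

/-- The `k`-th moment of the law on `(-1, 1)` with density proportional to `(1 - x²) ^ (q - 3/2)`: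
zero for odd `k`, and the quotient of rising factorials `(1/2)ⱼ / (q)ⱼ` for `k = 2j`. -/
def symmMoment (q : ℝ) (k : ℕ) : ℝ :=
  if Even k then
    Real.Gamma ((k : ℝ) / 2 + 1 / 2) * Real.Gamma q / (√Real.pi * Real.Gamma (q + k / 2))
  else 0

lemma integral_Ioi_rpow_mul_sub_rpow {u v R : ℝ} (hu : 0 < u) (hv : 0 < v) (hR : 0 < R) :
    ∫ x in Set.Ioi 0, (if x < R then x ^ (u - 1) * (R - x) ^ (v - 1) else 0) =
      R ^ (u + v - 1) * beta u v := by
  have h1 := Complex.betaIntegral_scaled (u : ℂ) (v : ℂ) hR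
  rw [Complex.betaIntegral_eq_Gamma_mul_div _ _ (by simpa) (by simpa),
    intervalIntegral.integral_of_le hR.le] at h1
  have h2 : ∫ x in Set.Ioc 0 R, (x : ℂ) ^ ((u : ℂ) - 1) * ((R : ℂ) - x) ^ ((v : ℂ) - 1) =
      ((∫ x in Set.Ioc 0 R, x ^ (u - 1) * (R - x) ^ (v - 1) : ℝ) : ℂ) := by
    rw [← integral_complex_ofReal]
    refine setIntegral_congr_fun measurableSet_Ioc fun x hx => ?_
    have := hx.2
    push_cast
    rw [Complex.ofReal_cpow hx.1.le, Complex.ofReal_cpow (by linarith)]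
    push_cast; rfl
  rw [h2, Complex.Gamma_ofReal, Complex.Gamma_ofReal, ← Complex.ofReal_add, Complex.Gamma_ofReal]
    at h1
  have h3 : ∫ x in Set.Ioc 0 R, x ^ (u - 1) * (R - x) ^ (v - 1) = R ^ (u + v - 1) * beta u v := by
    rw [← Complex.ofReal_inj, h1, beta]
    push_cast
    rw [Complex.ofReal_cpow hR.le]
    push_cast; rfl
  rw [← h3, integral_Ioc_eq_integral_Ioo]
  have : ∀ x : ℝ, (if x < R then x ^ (u - 1) * (R - x) ^ (v - 1) else 0) =
      (Set.Iio R).indicator (fun x => x ^ (u - 1) * (R - x) ^ (v - 1)) x := by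
    intro x; simp [Set.indicator_apply]
  simp_rw [this]
  rw [setIntegral_indicator measurableSet_Iio, Set.Ioi_inter_Iio]

/-- Radial part of the moments of the ball density, reduced to a Beta integral by `x = r²`. -/
lemma integral_Ioi_pow_mul_sq_sub_sq_rpow {p v R : ℝ} (hp : 0 < p) (hv : 0 < v) (hR : 0 < R) :
    ∫ r in Set.Ioi 0, r ^ (p - 1) * (if r < R then (R ^ 2 - r ^ 2) ^ (v - 1) else 0) =
      R ^ (p + 2 * v - 2) * beta (p / 2) v / 2 := by
  have h := integral_comp_rpow_Ioi (fun x : ℝ =>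
    if x < R ^ 2 then x ^ (p / 2 - 1) * (R ^ 2 - x) ^ (v - 1) else 0) (two_ne_zero)
  rw [integral_Ioi_rpow_mul_sub_rpow (by positivity) hv (by positivity)] at h
  have e : (R ^ 2) ^ (p / 2 + v - 1) = R ^ (p + 2 * v - 2) := by
    rw [← Real.rpow_natCast R 2, ← Real.rpow_mul hR.le]; congr 1; push_cast; ring
  rw [e] at h
  rw [← h, ← integral_div]
  refine setIntegral_congr_fun measurableSet_Ioi fun r (hr : 0 < r) => ?_
  have e1 : (r ^ (2 : ℝ)) = r ^ 2 := by exact_mod_cast Real.rpow_natCast r 2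
  have e2 : r < R ↔ r ^ 2 < R ^ 2 := (sq_lt_sq₀ hr.le hR.le).symm
  simp only [e1, smul_eq_mul, e2]
  split_ifs
  · have e3 : r ^ (p - 1) = r * (r ^ 2) ^ (p / 2 - 1) := by
      rw [← Real.rpow_natCast r 2, ← Real.rpow_mul hr.le]
      nth_rewrite 2 [← Real.rpow_one r]
      rw [← Real.rpow_add hr]; congr 1; push_cast; ring
    rw [e3]; norm_num; ring
  · simp

lemma integral_pow_mul_exp_neg_sq_of_even {k : ℕ} (hk : Even k) :
    ∫ x : ℝ, x ^ k * Real.exp (-x ^ 2) = Real.Gamma ((k : ℝ) / 2 + 1 / 2) := by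
  have h := integral_comp_abs (f := fun x => x ^ k * Real.exp (-x ^ 2))
  simp only [hk.pow_abs, sq_abs] at h
  have h2 := integral_rpow_mul_exp_neg_rpow (p := 2) (q := k) two_pos
    (by have : (0 : ℝ) ≤ k := by positivity
        linarith)
  rw [h]
  norm_cast at h2
  rw [h2]; push_cast
  rw [show ((k : ℝ) / 2 + 1 / 2) = ((k : ℝ) + 1) / 2 by ring]; ring

section Polar

variable {E : Type*} [NormedAddCommGroup E] [NormedSpace ℝ E] [MeasurableSpace E] [BorelSpace E]
  [FiniteDimensional ℝ E]

/-- Integration in polar coordinates of a product of an angular and a radial function. -/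
lemma integral_sphere_mul_radial [Nontrivial E] (μ : Measure E) [μ.IsAddHaarMeasure]
    (f : E → ℝ) (g : Metric.sphere (0 : E) 1 → ℝ) (h : ℝ → ℝ)
    (hf : ∀ (θ : Metric.sphere (0 : E) 1) (r : ℝ), 0 < r → f (r • (θ : E)) = g θ * h r) :
    ∫ x, f x ∂μ = (∫ θ, g θ ∂μ.toSphere) *
      ∫ r in Set.Ioi (0 : ℝ), r ^ (Module.finrank ℝ E - 1) * h r := by
  calc
    ∫ x, f x ∂μ = ∫ x : ({(0)}ᶜ : Set E), f x.1 ∂(μ.comap (↑)) := by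
      rw [integral_subtype_comap (measurableSet_singleton _).compl fun x ↦ f x,
        restrict_compl_singleton]
    _ = ∫ x : Metric.sphere (0 : E) 1 × Set.Ioi (0 : ℝ), g x.1 * h x.2
          ∂μ.toSphere.prod (.volumeIoiPow (Module.finrank ℝ E - 1)) := by
      rw [← μ.measurePreserving_homeomorphUnitSphereProd.integral_comp
        (Homeomorph.measurableEmbedding _)]
      congr 1; ext x
      rw [← hf _ _ (Subtype.prop ((homeomorphUnitSphereProd E) x).2)]
      have hx : ‖(x : E)‖ ≠ 0 := norm_ne_zero_iff.2 x.2
      congr 1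
      simp [smul_smul, hx]
    _ = (∫ θ, g θ ∂μ.toSphere) *
        ∫ x : Set.Ioi (0 : ℝ), h x ∂.volumeIoiPow (Module.finrank ℝ E - 1) :=
      integral_prod_mul g (fun x : Set.Ioi (0 : ℝ) => h x)
    _ = _ := by
      congr 1
      simp only [Measure.volumeIoiPow, ENNReal.ofReal]
      rw [integral_withDensity_eq_integral_smul,
        integral_subtype_comap measurableSet_Ioi
          fun a ↦ Real.toNNReal (a ^ (Module.finrank ℝ E - 1)) • h a,
        setIntegral_congr_fun measurableSet_Ioi fun x hx ↦ ?_]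
      · rw [NNReal.smul_def, Real.coe_toNNReal _ (pow_nonneg hx.out.le _), smul_eq_mul]
      · exact (measurable_subtype_coe.pow_const _).real_toNNReal

end Polar

/-! ### Moments of the uniform law on the sphere -/

lemma integral_pow_mul_exp_neg_sq (k : ℕ) :
    ∫ x : ℝ, x ^ k * Real.exp (-x ^ 2) =
      if Even k then Real.Gamma ((k : ℝ) / 2 + 1 / 2) else 0 := by
  split_ifs with hk
  · exact integral_pow_mul_exp_neg_sq_of_even hk
  · have hk := Nat.not_even_iff_odd.1 hk
    have h := integral_neg_eq_self (fun x : ℝ => x ^ k * Real.exp (-x ^ 2)) volume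
    simp only [hk.neg_pow, even_two.neg_pow, neg_mul, integral_neg] at h
    linarith

/-- By rotation invariance `ξ` may be taken along the first axis, where the integral factors. -/
lemma integral_inner_pow_mul_exp_neg_sq (d k : ℕ) (ξ : EuclideanSpace ℝ (Fin (d + 1))) :
    ∫ x : EuclideanSpace ℝ (Fin (d + 1)), inner ℝ ξ x ^ k * Real.exp (-‖x‖ ^ 2) =
      ‖ξ‖ ^ k * (if Even k then Real.Gamma ((k : ℝ) / 2 + 1 / 2) else 0) * √Real.pi ^ d := by
  -- `ρ` is the reflection that takes `ξ` to the first axis.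
  set w : EuclideanSpace ℝ (Fin (d + 1)) := ‖ξ‖ • EuclideanSpace.single 0 (1 : ℝ) with hw
  set ρ := (ℝ ∙ (ξ - w))ᗮ.reflection with hρ
  have hρw : ρ ξ = w := Submodule.reflection_sub (by simp [hw, norm_smul])
  have h1 : ∫ x, inner ℝ ξ x ^ k * Real.exp (-‖x‖ ^ 2) =
      ∫ x, inner ℝ w x ^ k * Real.exp (-‖x‖ ^ 2) := by
    rw [← ρ.measurePreserving.integral_comp ρ.toHomeomorph.measurableEmbedding
      (fun x => inner ℝ w x ^ k * Real.exp (-‖x‖ ^ 2))]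
    simp_rw [← hρw, LinearIsometryEquiv.inner_map_map, LinearIsometryEquiv.norm_map]
  rw [h1, ← (PiLp.volume_preserving_toLp (Fin (d + 1))).integral_comp
    (MeasurableEquiv.toLp 2 (Fin (d + 1) → ℝ)).measurableEmbedding]
  have h2 : ∀ x : Fin (d + 1) → ℝ,
      inner ℝ w (WithLp.toLp 2 x) ^ k * Real.exp (-‖WithLp.toLp 2 x‖ ^ 2) =
      ‖ξ‖ ^ k * ∏ i, (if i = 0 then x i ^ k else 1) * Real.exp (-x i ^ 2) := by
    intro x
    rw [Finset.prod_mul_distrib, Finset.prod_ite_eq' Finset.univ (0 : Fin (d + 1)),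
      ← Real.exp_sum, Finset.sum_neg_distrib, EuclideanSpace.norm_sq_eq]
    simp [hw, inner_smul_left, mul_pow, EuclideanSpace.inner_single_left, mul_assoc]
  simp_rw [h2]
  rw [integral_const_mul, integral_fintype_prod_volume_eq_prod
    (fun (i : Fin (d + 1)) (y : ℝ) => (if i = 0 then y ^ k else 1) * Real.exp (-y ^ 2)),
    Fin.prod_univ_succ]
  simp only [if_true, Fin.succ_ne_zero, if_false]
  rw [integral_pow_mul_exp_neg_sq, mul_assoc]
  have h0 := integral_pow_mul_exp_neg_sq 0
  simp at h0
  rw [← one_div, Real.Gamma_one_half_eq] at h0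
  simp [h0]

lemma integral_Ioi_pow_mul_exp_neg_sq (p : ℕ) :
    ∫ r in Set.Ioi (0 : ℝ), r ^ p * Real.exp (-r ^ 2) = Real.Gamma (((p : ℝ) + 1) / 2) / 2 := by
  have h2 := integral_rpow_mul_exp_neg_rpow (p := 2) (q := p) two_pos
    (by have : (0 : ℝ) ≤ p := by positivity
        linarith)
  norm_cast at h2
  rw [h2]; push_cast; ring

lemma sqrt_pi_pow (d : ℕ) : √Real.pi ^ d = Real.pi ^ ((d : ℝ) / 2) := by
  rw [Real.sqrt_eq_rpow, ← Real.rpow_natCast, ← Real.rpow_mul Real.pi_pos.le]; congr 1; ring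

/-- Moments of the linear functionals on the sphere, from those of the Gaussian density. -/
lemma integral_toSphere_inner_pow {d : ℕ} (hd : 1 ≤ d) (k : ℕ) (ξ : EuclideanSpace ℝ (Fin d)) :
    ∫ θ : Metric.sphere (0 : EuclideanSpace ℝ (Fin d)) 1,
        inner ℝ ξ (θ : EuclideanSpace ℝ (Fin d)) ^ k
        ∂(volume : Measure (EuclideanSpace ℝ (Fin d))).toSphere =
      2 * Real.pi ^ ((d : ℝ) / 2) / Real.Gamma (d / 2) * (‖ξ‖ ^ k * symmMoment (d / 2) k) := by
  obtain ⟨d, rfl⟩ : ∃ e, d = e + 1 := ⟨d - 1, by omega⟩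
  have h := integral_sphere_mul_radial (volume : Measure (EuclideanSpace ℝ (Fin (d + 1))))
    (fun x => inner ℝ ξ x ^ k * Real.exp (-‖x‖ ^ 2)) (fun θ => inner ℝ ξ θ.1 ^ k)
    (fun r => r ^ k * Real.exp (-r ^ 2)) (by
      intro θ r hr
      simp [norm_smul, inner_smul_right, mul_pow]; ring)
  simp only [finrank_euclideanSpace, Fintype.card_fin, Nat.add_sub_cancel, ← mul_assoc,
    ← pow_add] at h
  rw [integral_inner_pow_mul_exp_neg_sq, integral_Ioi_pow_mul_exp_neg_sq, sqrt_pi_pow] at h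
  have e1 : (((d + k : ℕ) : ℝ) + 1) / 2 = (((d + 1 : ℕ) : ℝ)) / 2 + k / 2 := by push_cast; ring
  rw [e1] at h
  have hG : 0 < Real.Gamma ((((d + 1 : ℕ) : ℝ)) / 2 + k / 2) :=
    Real.Gamma_pos_of_pos (by positivity)
  have hG2 : 0 < Real.Gamma ((((d + 1 : ℕ) : ℝ)) / 2) := Real.Gamma_pos_of_pos (by positivity)
  have hs : 0 < √Real.pi := Real.sqrt_pos.2 Real.pi_pos
  have e2 : Real.pi ^ (((d + 1 : ℕ) : ℝ) / 2) = Real.pi ^ ((d : ℝ) / 2) * √Real.pi := by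
    rw [← sqrt_pi_pow, ← sqrt_pi_pow, pow_succ]
  rw [e2, symmMoment]
  rw [eq_comm, ← eq_div_iff (by positivity)] at h
  rw [h]
  split_ifs
  · field_simp
  · simp

lemma toSphere_real_univ {d : ℕ} (hd : 1 ≤ d) :
    (volume : Measure (EuclideanSpace ℝ (Fin d))).toSphere.real Set.univ =
      2 * Real.pi ^ ((d : ℝ) / 2) / Real.Gamma (d / 2) := by
  have h := integral_toSphere_inner_pow hd 0 0
  have hG2 : 0 < Real.Gamma ((d : ℝ) / 2) := Real.Gamma_pos_of_pos (by positivity)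
  have hs : 0 < √Real.pi := Real.sqrt_pos.2 Real.pi_pos
  simp [symmMoment] at h
  rw [← one_div, Real.Gamma_one_half_eq, mul_comm √Real.pi, div_self (by positivity), mul_one] at h
  rw [← h]; simp

lemma integral_uniformSphere_inner_pow {d : ℕ} (hd : 1 ≤ d) (k : ℕ)
    (ξ : EuclideanSpace ℝ (Fin d)) :
    ∫ θ, inner ℝ ξ (θ : EuclideanSpace ℝ (Fin d)) ^ k ∂(uniformSphere d) =
      ‖ξ‖ ^ k * symmMoment (d / 2) k := by
  have hG2 : 0 < Real.Gamma ((d : ℝ) / 2) := Real.Gamma_pos_of_pos (by positivity)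
  rw [uniformSphere, integral_smul_measure, integral_toSphere_inner_pow hd, ENNReal.toReal_inv,
    ← measureReal_def, toSphere_real_univ hd, smul_eq_mul, inv_mul_cancel_left₀]
  positivity

/-! ### The densities on the ball -/

/-- The density on the ball of radius `R` in `ℝ^m`, proportional to `(R² - ‖x‖²) ^ (q - m/2 - 1)`.
The parameter `q` is chosen so that all these densities with the same `q` are marginals of one
another. -/
def ballDensity (m : ℕ) (q R : ℝ) (x : EuclideanSpace ℝ (Fin m)) : ℝ :=
  open Classical in
  if ‖x‖ < R then
    Real.Gamma q / Real.Gamma (q - m / 2) *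
      ((R ^ 2 - ‖x‖ ^ 2) ^ (q - m / 2 - 1) / (Real.pi ^ ((m : ℝ) / 2) * R ^ (2 * q - 2)))
  else 0

lemma measurable_ballDensity (m : ℕ) (q R : ℝ) : Measurable (ballDensity m q R) :=
  Measurable.ite (measurableSet_lt (by fun_prop) (by fun_prop)) (by fun_prop) (by fun_prop)

lemma ballDensity_nonneg {m : ℕ} {q R : ℝ} (hq : (m : ℝ) / 2 < q)
    (x : EuclideanSpace ℝ (Fin m)) : 0 ≤ ballDensity m q R x := by
  unfold ballDensity
  split_ifs with h
  · have hR : 0 < R := (norm_nonneg x).trans_lt h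
    have h0 : 0 < q := lt_of_le_of_lt (by positivity) hq
    have h1 := Real.Gamma_pos_of_pos h0
    have h2 := Real.Gamma_pos_of_pos (sub_pos.2 hq)
    have h3 : 0 ≤ R ^ 2 - ‖x‖ ^ 2 := by
      have := (sq_lt_sq₀ (norm_nonneg x) hR.le).2 h
      linarith
    positivity
  · exact le_rfl

/-- The moments of the linear functionals under `ballDensity m q R` depend on `q`, not on `m`; for
`k = 0` this is the normalization. -/
lemma integral_inner_pow_mul_ballDensity {m : ℕ} (hm : 1 ≤ m) {q R : ℝ} (hq : (m : ℝ) / 2 < q)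
    (hR : 0 < R) (k : ℕ) (ξ : EuclideanSpace ℝ (Fin m)) :
    ∫ x, ballDensity m q R x * inner ℝ ξ x ^ k = (R * ‖ξ‖) ^ k * symmMoment q k := by
  have : Nonempty (Fin m) := ⟨⟨0, hm⟩⟩
  have h := integral_sphere_mul_radial (volume : Measure (EuclideanSpace ℝ (Fin m)))
    (fun x => ballDensity m q R x * inner ℝ ξ x ^ k) (fun θ => inner ℝ ξ θ.1 ^ k)
    (fun r => Real.Gamma q / Real.Gamma (q - m / 2) /
      (Real.pi ^ ((m : ℝ) / 2) * R ^ (2 * q - 2)) *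
      (r ^ k * (if r < R then (R ^ 2 - r ^ 2) ^ ((q - m / 2) - 1) else 0))) (by
      intro θ r hr
      simp only [ballDensity, norm_smul, inner_smul_right, mul_pow, Real.norm_eq_abs,
        abs_of_pos hr, norm_eq_of_mem_sphere, mul_one]
      split_ifs <;> ring)
  rw [h, integral_toSphere_inner_pow hm]
  have h0 : 0 < q := lt_of_le_of_lt (by positivity) hq
  have hm0 : (0 : ℝ) < m := by exact_mod_cast hm
  have hI := integral_Ioi_pow_mul_sq_sub_sq_rpow (p := (m : ℝ) + k) (v := q - m / 2) (R := R)
    (by positivity) (sub_pos.2 hq) hR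
  have e1 : ∫ r in Set.Ioi (0 : ℝ), r ^ (Module.finrank ℝ (EuclideanSpace ℝ (Fin m)) - 1) *
      (Real.Gamma q / Real.Gamma (q - m / 2) / (Real.pi ^ ((m : ℝ) / 2) * R ^ (2 * q - 2)) *
      (r ^ k * (if r < R then (R ^ 2 - r ^ 2) ^ ((q - m / 2) - 1) else 0))) =
      Real.Gamma q / Real.Gamma (q - m / 2) / (Real.pi ^ ((m : ℝ) / 2) * R ^ (2 * q - 2)) *
      (R ^ ((m : ℝ) + k + 2 * (q - m / 2) - 2) * beta (((m : ℝ) + k) / 2) (q - m / 2) / 2) := by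
    rw [← hI, ← integral_const_mul]
    refine setIntegral_congr_fun measurableSet_Ioi fun r (hr : 0 < r) => ?_
    have e : r ^ ((m : ℝ) + k - 1) = r ^ (m - 1) * r ^ k := by
      rw [← pow_add, ← Real.rpow_natCast, Nat.cast_add, Nat.cast_sub hm]; congr 1; push_cast; ring
    simp only [e, finrank_euclideanSpace, Fintype.card_fin]
    ring
  rw [e1]
  have e2 : R ^ ((m : ℝ) + k + 2 * (q - m / 2) - 2) = R ^ (2 * q - 2) * R ^ k := by
    rw [← Real.rpow_natCast R k, ← Real.rpow_add hR]; congr 1; ring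
  have e3 : beta (((m : ℝ) + k) / 2) (q - m / 2) =
      Real.Gamma (m / 2 + k / 2) * Real.Gamma (q - m / 2) / Real.Gamma (q + k / 2) := by
    rw [beta, show ((m : ℝ) + k) / 2 = m / 2 + k / 2 by ring]
    congr 2; ring
  rw [e2, e3, symmMoment, symmMoment]
  have h1 := Real.Gamma_pos_of_pos h0
  have h2 := Real.Gamma_pos_of_pos (sub_pos.2 hq)
  have h3 : 0 < Real.Gamma ((m : ℝ) / 2) := Real.Gamma_pos_of_pos (by positivity)
  have h4 : 0 < Real.Gamma ((m : ℝ) / 2 + k / 2) := Real.Gamma_pos_of_pos (by positivity)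
  have h5 : 0 < Real.Gamma (q + k / 2) := Real.Gamma_pos_of_pos (by positivity)
  have hs : 0 < √Real.pi := Real.sqrt_pos.2 Real.pi_pos
  have h6 : 0 < R ^ (2 * q - 2) := by positivity
  rw [mul_pow]
  generalize Real.Gamma (q - m / 2) = G at h2 ⊢
  split_ifs
  · field_simp
  · simp

/-! ### The Dirichlet law of the durations -/

lemma durations_cons {n : ℕ} (t x : ℝ) (s : Fin n → ℝ) :
    durations t (Fin.cons x s : Fin (n + 1) → ℝ) = Fin.cons x (durations (t - x) s) := by
  rw [durations, durations, Fin.cons_snoc_eq_snoc_cons]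
  simp [Fin.sum_univ_succ, sub_sub]

lemma measurable_durations {n : ℕ} (t : ℝ) : Measurable (durations (n := n) t) := by
  refine measurable_pi_iff.2 fun j => ?_
  refine Fin.lastCases ?_ (fun i => ?_) j
  · simp only [durations, Fin.snoc_last]; fun_prop
  · simp only [durations, Fin.snoc_castSucc]; fun_prop

/-- The unnormalized Dirichlet density with arbitrary exponents `b j - 1`. -/
def dirichletKernel {n : ℕ} (b : Fin (n + 1) → ℝ) (t : ℝ) (s : Fin n → ℝ) : ℝ :=
  open Classical in
  if ∀ j, 0 < durations t s j then ∏ j, durations t s j ^ (b j - 1) else 0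

lemma measurable_dirichletKernel {n : ℕ} (b : Fin (n + 1) → ℝ) (t : ℝ) :
    Measurable (dirichletKernel b t) := by
  have h := measurable_pi_iff.1 (measurable_durations (n := n) t)
  refine Measurable.ite ?_ ?_ measurable_const
  · simp only [Set.ofPred_forall]
    exact MeasurableSet.iInter fun j => measurableSet_lt measurable_const (h j)
  · exact Finset.measurable_prod _ fun j _ => (h j).pow_const _

lemma dirichletKernel_nonneg {n : ℕ} (b : Fin (n + 1) → ℝ) (t : ℝ) (s : Fin n → ℝ) :
    0 ≤ dirichletKernel b t s := by
  unfold dirichletKernel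
  split_ifs with h
  · exact Finset.prod_nonneg fun j _ => Real.rpow_nonneg (h j).le _
  · exact le_rfl

lemma dirichletKernel_cons {n : ℕ} (b : Fin (n + 2) → ℝ) (t x : ℝ) (s : Fin n → ℝ) :
    dirichletKernel b t (Fin.cons x s : Fin (n + 1) → ℝ) =
      (if 0 < x then x ^ (b 0 - 1) else 0) * dirichletKernel (fun j => b j.succ) (t - x) s := by
  classical
  simp only [dirichletKernel, durations_cons, Fin.forall_fin_succ (n := n + 1), Fin.cons_zero,
    Fin.cons_succ, Fin.prod_univ_succ (n := n + 1)]
  split_ifs <;> simp_all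

lemma lintegral_rpow_mul_sub_rpow {u v t : ℝ} (hu : 0 < u) (hv : 0 < v) :
    ∫⁻ x : ℝ, ENNReal.ofReal ((if 0 < x then x ^ (u - 1) else 0) *
      (if 0 < t - x then (t - x) ^ (v - 1) else 0)) =
      ENNReal.ofReal (if 0 < t then t ^ (u + v - 1) * beta u v else 0) := by
  split_ifs with ht
  · have h := integral_Ioi_rpow_mul_sub_rpow hu hv ht
    -- The Bochner integral is nonzero, so the integrand is integrable.
    have hi := Integrable.of_integral_ne_zero
      (by rw [h]; exact (mul_pos (Real.rpow_pos_of_pos ht _) (beta_pos hu hv)).ne')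
    rw [← h, ofReal_integral_eq_lintegral_ofReal hi, ← lintegral_indicator measurableSet_Ioi]
    · congr 1; ext x
      simp only [Set.indicator_apply, Set.mem_Ioi, sub_pos]
      split_ifs <;> simp
    · filter_upwards [ae_restrict_mem measurableSet_Ioi] with x hx
      have hx : 0 < x := hx
      simp only [Pi.zero_apply]
      split_ifs with h
      · have := sub_pos.2 h
        positivity
      · exact le_rfl
  · rw [ENNReal.ofReal_zero, ← lintegral_zero (μ := (volume : Measure ℝ))]
    congr 1; ext x
    split_ifs <;> first | (exfalso; linarith) | simp

/-- The Dirichlet integral. The induction peels off the first duration, so the total length `t`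
has to be arbitrary, including `t ≤ 0`. -/
lemma lintegral_dirichletKernel (n : ℕ) (b : Fin (n + 1) → ℝ) (hb : ∀ j, 0 < b j) (t : ℝ) :
    ∫⁻ s, ENNReal.ofReal (dirichletKernel b t s) =
      ENNReal.ofReal ((∏ j, Real.Gamma (b j)) / Real.Gamma (∑ j, b j) *
        if 0 < t then t ^ (∑ j, b j - 1) else 0) := by
  induction n generalizing t with
  | zero =>
    have h : (Real.Gamma (b 0)) ≠ 0 := (Real.Gamma_pos_of_pos (hb 0)).ne'
    simp [lintegral_unique, dirichletKernel, durations, Fin.snoc, h, volume_pi]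
  | succ n ih =>
    have hB : 0 < ∑ j : Fin (n + 1), b j.succ :=
      Finset.sum_pos (fun j _ => hb _) Finset.univ_nonempty
    have hP : 0 < ∏ j : Fin (n + 1), Real.Gamma (b j.succ) :=
      Finset.prod_pos fun j _ => Real.Gamma_pos_of_pos (hb _)
    have hG := Real.Gamma_pos_of_pos hB
    have hm := measurable_dirichletKernel b t
    have e : ∀ p : ℝ × (Fin n → ℝ),
        (MeasurableEquiv.piFinSuccAbove (fun _ : Fin (n + 1) => ℝ) 0).symm p =
          Fin.cons p.1 p.2 := by
      intro p; simp [MeasurableEquiv.piFinSuccAbove]; rfl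
    rw [← ((volume_preserving_piFinSuccAbove (fun _ : Fin (n + 1) => ℝ) 0).symm _).lintegral_comp
      hm.ennreal_ofReal, Measure.volume_eq_prod, lintegral_prod (fun p => ENNReal.ofReal
        (dirichletKernel b t ((MeasurableEquiv.piFinSuccAbove (fun _ => ℝ) 0).symm p)))
        (hm.ennreal_ofReal.comp (MeasurableEquiv.measurable _)).aemeasurable]
    simp only [e, dirichletKernel_cons]
    have h1 : ∀ x : ℝ, ∫⁻ s : Fin n → ℝ, ENNReal.ofReal ((if 0 < x then x ^ (b 0 - 1) else 0) *
        dirichletKernel (fun j => b j.succ) (t - x) s) =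
        ENNReal.ofReal ((∏ j : Fin (n + 1), Real.Gamma (b j.succ)) /
          Real.Gamma (∑ j : Fin (n + 1), b j.succ)) *
        ENNReal.ofReal ((if 0 < x then x ^ (b 0 - 1) else 0) *
          if 0 < t - x then (t - x) ^ (∑ j : Fin (n + 1), b j.succ - 1) else 0) := by
      intro x
      have hx : 0 ≤ (if 0 < x then x ^ (b 0 - 1) else 0) := by
        split_ifs with h
        · positivity
        · exact le_rfl
      simp_rw [ENNReal.ofReal_mul hx]
      rw [lintegral_const_mul _ (measurable_dirichletKernel _ _).ennreal_ofReal,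
        ih _ (fun j => hb _), ENNReal.ofReal_mul (by positivity)]
      ring
    simp_rw [h1]
    rw [lintegral_const_mul', lintegral_rpow_mul_sub_rpow (hb 0) hB,
      ← ENNReal.ofReal_mul (by positivity), Fin.sum_univ_succ b,
      Fin.prod_univ_succ (fun j => Real.Gamma (b j))]
    · congr 1
      split_ifs
      · rw [beta]; field_simp
      · simp
    · exact ENNReal.ofReal_ne_top

lemma dirichletDensity_eq (n : ℕ) (a t : ℝ) (s : Fin n → ℝ) :
    dirichletDensity n a t s = Real.Gamma ((n + 1) * a) / Real.Gamma a ^ (n + 1) *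
      (1 / t ^ ((n + 1) * a - 1)) * dirichletKernel (fun _ => a) t s := by
  simp only [dirichletDensity, dirichletKernel]
  split_ifs <;> simp

lemma measurable_dirichletDensity (n : ℕ) (a t : ℝ) : Measurable (dirichletDensity n a t) := by
  simp_rw [funext (dirichletDensity_eq n a t)]
  exact (measurable_dirichletKernel _ _).const_mul _

lemma dirichletDensity_nonneg (n : ℕ) {a t : ℝ} (ha : 0 < a) (ht : 0 < t) (s : Fin n → ℝ) :
    0 ≤ dirichletDensity n a t s := by
  rw [dirichletDensity_eq]
  have := dirichletKernel_nonneg (fun _ => a) t s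
  have h1 := Real.Gamma_pos_of_pos ha
  have h2 : 0 < Real.Gamma ((n + 1) * a) := Real.Gamma_pos_of_pos (by positivity)
  positivity

/-- The law of the first `n` durations. -/
abbrev dirichletLaw (n : ℕ) (a t : ℝ) : Measure (Fin n → ℝ) :=
  volume.withDensity fun s => ENNReal.ofReal (dirichletDensity n a t s)

lemma ae_dirichletLaw_durations_pos (n : ℕ) (a t : ℝ) :
    ∀ᵐ s ∂(dirichletLaw n a t), ∀ j, 0 < durations t s j := by
  rw [ae_withDensity_iff (measurable_dirichletDensity n a t).ennreal_ofReal]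
  refine Filter.Eventually.of_forall fun s hs => ?_
  by_contra h
  exact hs (by simp [dirichletDensity, h])

lemma sum_durations {n : ℕ} (t : ℝ) (s : Fin n → ℝ) : ∑ j, durations t s j = t := by
  rw [Fin.sum_univ_castSucc]; simp [durations]

/-- Mixed moments of the durations. -/
lemma integral_dirichletLaw_prod_pow (n : ℕ) {a t : ℝ} (ha : 0 < a) (ht : 0 < t)
    (k : Fin (n + 1) → ℕ) :
    ∫ s, ∏ j, durations t s j ^ k j ∂(dirichletLaw n a t) =
      t ^ (∑ j, k j) * (∏ j, Real.Gamma (a + k j) / Real.Gamma a) *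
        (Real.Gamma ((n + 1) * a) / Real.Gamma ((n + 1) * a + (∑ j, k j : ℕ))) := by
  rw [integral_withDensity_eq_integral_toReal_smul
    (measurable_dirichletDensity n a t).ennreal_ofReal (by simp)]
  have hb : ∀ j, 0 < a + k j := fun j => by positivity
  have e : ∀ s : Fin n → ℝ, (ENNReal.ofReal (dirichletDensity n a t s)).toReal •
      ∏ j, durations t s j ^ k j = Real.Gamma ((n + 1) * a) / Real.Gamma a ^ (n + 1) *
      (1 / t ^ ((n + 1) * a - 1)) * dirichletKernel (fun j => a + k j) t s := by
    intro s
    rw [ENNReal.toReal_ofReal (dirichletDensity_nonneg n ha ht s), dirichletDensity_eq, smul_eq_mul,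
      mul_assoc]
    congr 1
    simp only [dirichletKernel]
    split_ifs with h
    · rw [← Finset.prod_mul_distrib]
      refine Finset.prod_congr rfl fun j _ => ?_
      rw [← Real.rpow_natCast, ← Real.rpow_add (h j)]
      congr 1; ring
    · simp
  simp_rw [e]
  rw [integral_const_mul, integral_eq_lintegral_of_nonneg_ae
    (Filter.Eventually.of_forall (dirichletKernel_nonneg _ _))
    (measurable_dirichletKernel _ _).aestronglyMeasurable, lintegral_dirichletKernel n _ hb,
    if_pos ht]
  have hs : ∑ j, (a + (k j : ℝ)) = (n + 1) * a + (∑ j, k j : ℕ) := by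
    rw [Finset.sum_add_distrib]; push_cast; simp
  have hP : 0 < ∏ j, Real.Gamma (a + k j) :=
    Finset.prod_pos fun j _ => Real.Gamma_pos_of_pos (hb _)
  have hG : 0 < Real.Gamma ((n + 1) * a + (∑ j, k j : ℕ)) := Real.Gamma_pos_of_pos (by positivity)
  rw [hs, ENNReal.toReal_ofReal (by positivity), Finset.prod_div_distrib, Finset.prod_const,
    Finset.card_univ, Fintype.card_fin]
  have e2 : t ^ ((n + 1) * a + (∑ j, k j : ℕ) - 1) =
      t ^ ((n + 1) * a - 1) * t ^ (∑ j, k j) := by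
    rw [← Real.rpow_natCast, ← Real.rpow_add ht]; congr 1; ring
  rw [e2]
  have h3 := Real.Gamma_pos_of_pos ha
  field_simp

/-! ### The semigroup property of the moment series -/

lemma symmMoment_zero {q : ℝ} (hq : 0 < q) : symmMoment q 0 = 1 := by
  have h1 := Real.Gamma_pos_of_pos hq
  have hs : 0 < √Real.pi := Real.sqrt_pos.2 Real.pi_pos
  simp only [symmMoment, Even.zero, if_true, Nat.cast_zero, zero_div, zero_add, add_zero,
    Real.Gamma_one_half_eq]
  field_simp

/-- If `F_x(z) = ∑ pₖ(x) zᵏ` has polynomial coefficients, `F_0 = 1` and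
`F_{x+s} = F_x + r z² F_{x+s'}`, then `F_x F_y = F_{x+y}`. For fixed `y` the defect of the `k`-th
coefficient is a polynomial in `x`, zero at `0` and, by induction on `k`, periodic with period
`s`. -/
lemma sum_antidiagonal_eval_mul_eval (p : ℕ → Polynomial ℝ) (s s' r : ℝ) (hs : 0 < s)
    (h0 : p 0 = 1) (h1 : p 1 = 0) (hz : ∀ k, (p (k + 1)).eval 0 = 0)
    (hrec : ∀ k x, (p (k + 2)).eval (x + s) = (p (k + 2)).eval x + r * (p k).eval (x + s'))
    (k : ℕ) (x y : ℝ) :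
    ∑ i ∈ Finset.HasAntidiagonal.antidiagonal k, (p i.1).eval x * (p i.2).eval y =
      (p k).eval (x + y) := by
  induction k using Nat.strong_induction_on generalizing x y with
  | _ k ih =>
  match k with
  | 0 => simp [h0]
  | 1 => simp [Finset.Nat.antidiagonal_succ, h1]
  | k + 2 =>
    -- By the induction hypothesis both sides of the claim change equally under `x ↦ x + s`.
    have step : ∀ x y,
        ∑ i ∈ Finset.HasAntidiagonal.antidiagonal (k + 2), (p i.1).eval (x + s) * (p i.2).eval y -
        ∑ i ∈ Finset.HasAntidiagonal.antidiagonal (k + 2), (p i.1).eval x * (p i.2).eval y =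
        (p (k + 2)).eval (x + s + y) - (p (k + 2)).eval (x + y) := by
      intro x y
      have e : (p (k + 2)).eval (x + s + y) = (p (k + 2)).eval (x + y) +
          r * (p k).eval (x + y + s') := by rw [← hrec]; congr 1; ring
      rw [e, show x + y + s' = (x + s') + y by ring, ← ih k (by omega),
        Finset.Nat.sum_antidiagonal_succ, Finset.Nat.sum_antidiagonal_succ,
        Finset.Nat.sum_antidiagonal_succ, Finset.Nat.sum_antidiagonal_succ]
      simp only [hrec, h0, h1, zero_add, Polynomial.eval_one, Polynomial.eval_zero, zero_mul,
        add_mul, Finset.sum_add_distrib, mul_assoc, ← Finset.mul_sum]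
      ring
    let D : Polynomial ℝ :=
      ∑ i ∈ Finset.HasAntidiagonal.antidiagonal (k + 2), p i.1 * Polynomial.C ((p i.2).eval y)
      - (p (k + 2)).comp (Polynomial.X + Polynomial.C y)
    have hD : ∀ x, D.eval x =
        ∑ i ∈ Finset.HasAntidiagonal.antidiagonal (k + 2), (p i.1).eval x * (p i.2).eval y -
        (p (k + 2)).eval (x + y) := by
      intro x
      simp [D, Polynomial.eval_finsetSum, Polynomial.eval_comp]
    -- The defect `D` of the claim is a polynomial in `x` that vanishes at all multiples of `s`.
    have hper : ∀ j : ℕ, D.eval (j * s) = 0 := by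
      intro j
      induction j with
      | zero =>
        rw [hD, Finset.Nat.sum_antidiagonal_succ]
        simp [hz, h0]
      | succ j ihj =>
        rw [hD] at ihj ⊢
        have := step (j * s) y
        push_cast
        rw [show ((j : ℝ) + 1) * s = j * s + s by ring]
        linarith
    have hD0 : D = 0 := by
      refine Polynomial.eq_of_infinite_eval_eq _ _ (Set.Infinite.mono ?_
        (Set.infinite_range_of_injective (f := fun j : ℕ => (j : ℝ) * s) ?_))
      · rintro _ ⟨j, rfl⟩
        simpa using hper j
      · intro i j hij
        simpa [hs.ne'] using hij
    have := hD x
    rw [hD0] at this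
    simp at this
    linarith

/-- The generating function `∑ₖ (a)ₖ mₖ zᵏ / k!` where `(a)ₖ` is the rising factorial and `mₖ` the
`k`-th moment of a symmetric variable `U` on `(-1, 1)`; formally it is the expectation of
`(1 - z U) ^ (-a)`. -/
def momentSeries (q a : ℝ) : PowerSeries ℝ :=
  PowerSeries.mk fun k =>
    Real.Gamma (a + k) / Real.Gamma a * symmMoment q k / (k.factorial : ℝ)

lemma symmMoment_odd (q : ℝ) (j : ℕ) : symmMoment q (2 * j + 1) = 0 := by
  rw [symmMoment, if_neg (by simp)]

lemma symmMoment_even_succ {q : ℝ} (hq : 0 < q) (j : ℕ) :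
    symmMoment q (2 * (j + 1)) = symmMoment q (2 * j) * ((j + 1 / 2) / (q + j)) := by
  rw [symmMoment, symmMoment, if_pos (even_two_mul _), if_pos (even_two_mul _)]
  have e1 : ((2 * (j + 1) : ℕ) : ℝ) / 2 + 1 / 2 = (j + 1 / 2) + 1 := by push_cast; ring
  have e2 : q + ((2 * (j + 1) : ℕ) : ℝ) / 2 = (q + j) + 1 := by push_cast; ring
  have e3 : ((2 * j : ℕ) : ℝ) / 2 = j := by push_cast; ring
  rw [e1, e2, e3, Real.Gamma_add_one (by positivity), Real.Gamma_add_one (by positivity)]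
  have h1 : 0 < Real.Gamma (q + j) := Real.Gamma_pos_of_pos (by positivity)
  have hs : 0 < √Real.pi := Real.sqrt_pos.2 Real.pi_pos
  field_simp

lemma coeff_momentSeries_zero {q a : ℝ} (hq : 0 < q) (ha : 0 < a) :
    PowerSeries.coeff 0 (momentSeries q a) = 1 := by
  have h1 := Real.Gamma_pos_of_pos ha
  simp [momentSeries, symmMoment_zero hq, h1.ne']

lemma coeff_momentSeries_odd (q a : ℝ) (j : ℕ) :
    PowerSeries.coeff (2 * j + 1) (momentSeries q a) = 0 := by
  simp [momentSeries, symmMoment_odd]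

lemma coeff_momentSeries_even_succ {q a : ℝ} (hq : 0 < q) (ha : 0 < a) (j : ℕ) :
    PowerSeries.coeff (2 * (j + 1)) (momentSeries q a) =
      PowerSeries.coeff (2 * j) (momentSeries q a) *
        ((a + 2 * j) * (a + 2 * j + 1) / (4 * (j + 1) * (q + j))) := by
  simp only [momentSeries, PowerSeries.coeff_mk]
  rw [symmMoment_even_succ hq, show 2 * (j + 1) = 2 * j + 1 + 1 by ring, Nat.factorial_succ,
    Nat.factorial_succ]
  have e : a + ((2 * j + 1 + 1 : ℕ) : ℝ) = a + 2 * j + 1 + 1 := by push_cast; ring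
  have e2 : a + ((2 * j : ℕ) : ℝ) = a + 2 * j := by push_cast; ring
  rw [e, e2, Real.Gamma_add_one (by positivity), Real.Gamma_add_one (by positivity)]
  have h1 := Real.Gamma_pos_of_pos ha
  push_cast
  field_simp
  ring

/-- A sequence supported on the even integers, given by its even part. -/
def evenSeq {R : Type*} [Zero R] (f : ℕ → R) (k : ℕ) : R := if Even k then f (k / 2) else 0

lemma evenSeq_even {R : Type*} [Zero R] (f : ℕ → R) (j : ℕ) : evenSeq f (2 * j) = f j := by
  simp [evenSeq]

lemma evenSeq_odd {R : Type*} [Zero R] (f : ℕ → R) (j : ℕ) : evenSeq f (2 * j + 1) = 0 := by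
  simp [evenSeq]

/-- If the even coefficients of the moment series are the values of polynomials satisfying a
difference equation, its powers are again moment series. The polynomials are recognized by the ratio
of successive even coefficients of `momentSeries (q a) a`. -/
lemma momentSeries_pow (q : ℝ → ℝ) (hq : ∀ a, 0 < a → 0 < q a) (f : ℕ → Polynomial ℝ)
    (s s' r : ℝ) (hs : 0 < s) (h0 : f 0 = 1) (hz : ∀ j, (f (j + 1)).eval 0 = 0)
    (hrec : ∀ j x, (f (j + 1)).eval (x + s) = (f (j + 1)).eval x + r * (f j).eval (x + s'))
    (hratio : ∀ j a, 0 < a → (f (j + 1)).eval a =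
      (f j).eval a * ((a + 2 * j) * (a + 2 * j + 1) / (4 * (j + 1) * (q a + j))))
    (n : ℕ) {a : ℝ} (ha : 0 < a) :
    momentSeries (q a) a ^ (n + 1) = momentSeries (q ((n + 1) * a)) ((n + 1) * a) := by
  have hcoeff : ∀ a, 0 < a → ∀ k,
      PowerSeries.coeff k (momentSeries (q a) a) = (evenSeq f k).eval a := by
    intro a ha k
    obtain ⟨j, rfl | rfl⟩ := Nat.even_or_odd' k
    · induction j with
      | zero => rw [coeff_momentSeries_zero (hq a ha) ha]; simp [evenSeq, h0]
      | succ j ih =>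
        rw [coeff_momentSeries_even_succ (hq a ha) ha, ih, evenSeq_even, evenSeq_even,
          hratio j a ha]
    · rw [coeff_momentSeries_odd, evenSeq_odd]; simp
  have hmul : ∀ a b, 0 < a → 0 < b → momentSeries (q a) a * momentSeries (q b) b =
      momentSeries (q (a + b)) (a + b) := by
    intro a b ha hb
    ext k
    rw [PowerSeries.coeff_mul, hcoeff _ (add_pos ha hb)]
    simp_rw [hcoeff a ha, hcoeff b hb]
    refine sum_antidiagonal_eval_mul_eval (evenSeq f) s s' r hs (by simp [evenSeq, h0])
      (by simp [evenSeq]) ?_ ?_ k a b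
    · intro k
      obtain ⟨j, rfl | rfl⟩ := Nat.even_or_odd' k
      · rw [evenSeq_odd]; simp
      · rw [show 2 * j + 1 + 1 = 2 * (j + 1) by ring, evenSeq_even, hz]
    · intro k x
      obtain ⟨j, rfl | rfl⟩ := Nat.even_or_odd' k
      · rw [show 2 * j + 2 = 2 * (j + 1) by ring, evenSeq_even, evenSeq_even, hrec]
      · rw [show 2 * j + 1 + 2 = 2 * (j + 1) + 1 by ring, evenSeq_odd, evenSeq_odd]; simp
  induction n with
  | zero => simp
  | succ n ih =>
    rw [pow_succ, ih, hmul _ _ (by positivity) ha]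
    congr 1 <;> push_cast <;> ring_nf

/-- Here `momentSeries ((a + 1) / 2) a` is the binomial series of `F_a = (1 - z²) ^ (-a/2)`, so that
`F_{a+2} = F_a + z² F_{a+2}`. -/
lemma momentSeries_half_pow (n : ℕ) {a : ℝ} (ha : 0 < a) :
    momentSeries ((a + 1) / 2) a ^ (n + 1) =
      momentSeries (((n + 1) * a + 1) / 2) ((n + 1) * a) := by
  have hS : ∀ (j : ℕ) (x : ℝ), (ascPochhammer ℝ (j + 1)).eval x =
      x * (ascPochhammer ℝ j).eval (x + 1) := by
    intro j x
    rw [ascPochhammer_succ_left]; simp [Polynomial.eval_comp]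
  refine momentSeries_pow (fun a => (a + 1) / 2) (fun a ha => by positivity)
    (fun j => Polynomial.C (1 / (j.factorial : ℝ)) *
      (ascPochhammer ℝ j).comp (Polynomial.C (1 / 2) * Polynomial.X)) 2 2 1 two_pos
    (by simp) ?_ ?_ ?_ n ha
  · intro j
    simp [Polynomial.eval_comp, hS]
  · intro j x
    simp only [Polynomial.eval_mul, Polynomial.eval_C, Polynomial.eval_comp, Polynomial.eval_X]
    rw [show 1 / 2 * (x + 2) = 1 / 2 * x + 1 by ring, ascPochhammer_succ_eval, hS,
      Nat.factorial_succ]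
    push_cast
    field_simp
    ring
  · intro j a ha
    simp only [Polynomial.eval_mul, Polynomial.eval_C, Polynomial.eval_comp, Polynomial.eval_X]
    rw [ascPochhammer_succ_eval, Nat.factorial_succ]
    push_cast
    field_simp
    ring

/-- Here `momentSeries (a + 1) a` is the series of `C ^ a` with `C = 2 / (1 + √(1 - z²))`, the
Catalan generating function at `z² / 4`. The difference equation comes from
`C = 1 + (z² / 4) C²`. -/
lemma momentSeries_add_one_pow (n : ℕ) {a : ℝ} (ha : 0 < a) :
    momentSeries (a + 1) a ^ (n + 1) =
      momentSeries ((n + 1) * a + 1) ((n + 1) * a) := by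
  have hS : ∀ (j : ℕ) (x : ℝ), (ascPochhammer ℝ (j + 1)).eval x =
      x * (ascPochhammer ℝ j).eval (x + 1) := by
    intro j x
    rw [ascPochhammer_succ_left]; simp [Polynomial.eval_comp]
  let f : ℕ → Polynomial ℝ := fun j => match j with
    | 0 => 1
    | j + 1 => Polynomial.C (1 / (4 ^ (j + 1) * ((j + 1).factorial : ℝ))) * Polynomial.X *
      (ascPochhammer ℝ j).comp (Polynomial.X + Polynomial.C ((j : ℝ) + 2))
  have hf : ∀ (j : ℕ) (x : ℝ), (f (j + 1)).eval x = 1 / (4 ^ (j + 1) * ((j + 1).factorial : ℝ)) *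
      x * (ascPochhammer ℝ j).eval (x + (j + 2)) := by
    intro j x; simp [f, Polynomial.eval_comp]
  refine momentSeries_pow (fun a => a + 1) (fun a ha => by positivity)
    f 1 2 (1 / 4) one_pos rfl ?_ ?_ ?_ n ha
  · intro j
    simp [hf]
  · intro j x
    rcases j with _ | j
    · rw [hf, hf]; simp [f]; ring
    · rw [hf, hf, hf, hS j (x + _), ascPochhammer_succ_eval, Nat.factorial_succ (j + 1)]
      have e : x + 1 + (((j + 1 : ℕ) : ℝ) + 2) = x + 2 + ((j : ℝ) + 2) := by push_cast; ring
      have e' : x + (((j + 1 : ℕ) : ℝ) + 2) + 1 = x + 2 + ((j : ℝ) + 2) := by push_cast; ring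
      rw [e, e']
      push_cast
      field_simp
      ring
  · intro j a ha
    rcases j with _ | j
    · rw [hf]; simp [f]; field_simp
    · have e : a + (((j + 1 : ℕ) : ℝ) + 2) = a + ((j : ℝ) + 2) + 1 := by push_cast; ring
      have h2 : (ascPochhammer ℝ (j + 1)).eval (a + ((j + 1 : ℕ) + 2)) * (a + (j + 2)) =
          (ascPochhammer ℝ j).eval (a + (j + 2)) * ((a + 2 * j + 2) * (a + 2 * j + 3)) := by
        rw [e, mul_comm, ← hS, ascPochhammer_succ_eval, ascPochhammer_succ_eval]
        push_cast; ring
      have h3 : (0 : ℝ) < a + (j + 2) := by positivity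
      rw [← eq_div_iff h3.ne'] at h2
      rw [hf, hf, h2, Nat.factorial_succ (j + 1)]
      push_cast
      field_simp
      ring

/-! ### Measures determined by their moments -/

section Moments

variable {E : Type*} [NormedAddCommGroup E] [InnerProductSpace ℝ E] [MeasurableSpace E]
  [BorelSpace E]

/-- The characteristic function of a boundedly supported measure as a power series. -/
lemma hasSum_charFun (μ : Measure E) [IsFiniteMeasure μ] {R : ℝ} (hμ : ∀ᵐ x ∂μ, ‖x‖ ≤ R) (ξ : E) :
    HasSum (fun k : ℕ => ((∫ x, inner ℝ ξ x ^ k ∂μ : ℝ) : ℂ) * Complex.I ^ k / k.factorial)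
      (charFun μ ξ) := by
  have hb : ∀ k : ℕ, ∀ᵐ x ∂μ, ‖((inner ℝ ξ x : ℂ) * Complex.I) ^ k / k.factorial‖ ≤
      (‖ξ‖ * R) ^ k / k.factorial := by
    intro k
    filter_upwards [hμ] with x hx
    rw [norm_div, norm_pow, norm_mul, Complex.norm_I, mul_one, Complex.norm_real,
      Complex.norm_natCast]
    gcongr
    exact (norm_inner_le_norm _ _).trans (by gcongr)
  have hm : ∀ k : ℕ, AEStronglyMeasurable
      (fun x : E => ((inner ℝ ξ x : ℂ) * Complex.I) ^ k / k.factorial) μ := fun k => by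
    apply Continuous.aestronglyMeasurable
    fun_prop
  have h := hasSum_integral_of_dominated_convergence (μ := μ)
    (F := fun (k : ℕ) x => ((inner ℝ ξ x : ℂ) * Complex.I) ^ k / k.factorial)
    (f := fun x => Complex.exp ((inner ℝ x ξ : ℝ) * Complex.I))
    (fun k _ => (‖ξ‖ * R) ^ k / k.factorial) hm hb
    (Filter.Eventually.of_forall fun _ => Real.summable_pow_div_factorial _)
    (integrable_const _) (Filter.Eventually.of_forall fun x => by
      rw [real_inner_comm, Complex.exp_eq_exp_ℂ]
      exact NormedSpace.expSeries_div_hasSum_exp _)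
  rw [charFun_apply]
  have e : ∀ k : ℕ, ((∫ x, inner ℝ ξ x ^ k ∂μ : ℝ) : ℂ) * Complex.I ^ k / k.factorial =
      ∫ x, ((inner ℝ ξ x : ℂ) * Complex.I) ^ k / k.factorial ∂μ := fun k => by
    simp_rw [mul_pow, mul_div_assoc]
    rw [integral_mul_const, ← integral_complex_ofReal]
    push_cast; rfl
  simpa only [e] using h

/-- A boundedly supported measure is determined by the moments of all linear functionals. -/
lemma ext_of_moments [SecondCountableTopology E] [CompleteSpace E] {μ ν : Measure E}
    [IsFiniteMeasure μ] [IsFiniteMeasure ν] {R : ℝ} (hμ : ∀ᵐ x ∂μ, ‖x‖ ≤ R) (hν : ∀ᵐ x ∂ν, ‖x‖ ≤ R)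
    (h : ∀ (ξ : E) (k : ℕ), ∫ x, inner ℝ ξ x ^ k ∂μ = ∫ x, inner ℝ ξ x ^ k ∂ν) : μ = ν := by
  refine Measure.ext_of_charFun (funext fun ξ => ?_)
  have h1 := hasSum_charFun μ hμ ξ
  simp_rw [h] at h1
  exact h1.unique (hasSum_charFun ν hν ξ)

end Moments

/-- The law on the ball of radius `R` in `ℝ^m` with density `ballDensity m q R`. -/
abbrev ballLaw (m : ℕ) (q R : ℝ) : Measure (EuclideanSpace ℝ (Fin m)) :=
  volume.withDensity fun x => ENNReal.ofReal (ballDensity m q R x)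

lemma isFiniteMeasure_ballLaw {m : ℕ} (hm : 1 ≤ m) {q R : ℝ} (hq : (m : ℝ) / 2 < q) (hR : 0 < R) :
    IsFiniteMeasure (ballLaw m q R) := by
  have h0 : 0 < q := lt_of_le_of_lt (by positivity) hq
  have h := integral_inner_pow_mul_ballDensity hm hq hR 0 0
  simp only [pow_zero, mul_one, symmMoment_zero h0] at h
  exact isFiniteMeasure_withDensity_ofReal
    (Integrable.of_integral_ne_zero (by rw [h]; exact one_ne_zero)).2

lemma ae_ballLaw_norm_le (m : ℕ) (q R : ℝ) : ∀ᵐ x ∂(ballLaw m q R), ‖x‖ ≤ R := by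
  rw [ae_withDensity_iff (measurable_ballDensity m q R).ennreal_ofReal]
  refine Filter.Eventually.of_forall fun x hx => ?_
  by_contra h
  exact hx (by simp [ballDensity, not_lt.2 (not_le.1 h).le])

lemma integral_ballLaw_inner_pow {m : ℕ} (hm : 1 ≤ m) {q R : ℝ} (hq : (m : ℝ) / 2 < q)
    (hR : 0 < R) (k : ℕ) (ξ : EuclideanSpace ℝ (Fin m)) :
    ∫ x, inner ℝ ξ x ^ k ∂(ballLaw m q R) = (R * ‖ξ‖) ^ k * symmMoment q k := by
  rw [integral_withDensity_eq_integral_toReal_smul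
    (measurable_ballDensity m q R).ennreal_ofReal (by simp),
    ← integral_inner_pow_mul_ballDensity hm hq hR]
  congr 1; ext x
  rw [ENNReal.toReal_ofReal (ballDensity_nonneg hq x), smul_eq_mul]

/-! ### Law of the projected position -/

/-- The adjoint of the projection pads a vector with zeros, hence preserves norms. -/
lemma exists_inner_proj {m d : ℕ} (h : m ≤ d) (ξ : EuclideanSpace ℝ (Fin m)) :
    ∃ ζ : EuclideanSpace ℝ (Fin d), ‖ζ‖ = ‖ξ‖ ∧ ∀ x, inner ℝ ξ (proj h x) = inner ℝ ζ x := by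
  obtain ⟨e, rfl⟩ := Nat.exists_eq_add_of_le h
  refine ⟨WithLp.toLp 2 (Fin.append ξ 0), ?_, fun x => ?_⟩
  · rw [EuclideanSpace.norm_eq, EuclideanSpace.norm_eq, Fin.sum_univ_add]
    simp
  · rw [PiLp.inner_apply, PiLp.inner_apply, Fin.sum_univ_add]
    simp [proj, Fin.castAdd]

lemma measurable_proj {m d : ℕ} (h : m ≤ d) : Measurable (proj h) := by
  unfold proj
  fun_prop

lemma norm_proj_le {m d : ℕ} (h : m ≤ d) (x : EuclideanSpace ℝ (Fin d)) : ‖proj h x‖ ≤ ‖x‖ := by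
  obtain ⟨e, rfl⟩ := Nat.exists_eq_add_of_le h
  rw [EuclideanSpace.norm_eq, EuclideanSpace.norm_eq, Fin.sum_univ_add]
  refine Real.sqrt_le_sqrt ?_
  simp only [proj]
  exact le_add_of_nonneg_right (Finset.sum_nonneg fun _ _ => sq_nonneg _)

section Flight

variable {Ω : Type*} [MeasurableSpace Ω] {P : Measure Ω}
  {d n : ℕ} {a c t : ℝ} {τ : Ω → Fin n → ℝ}
  {θ : Fin (n + 1) → Ω → Metric.sphere (0 : EuclideanSpace ℝ (Fin d)) 1}

lemma IsFlightData.ae_durations_pos (h : IsFlightData P d n a t τ θ) :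
    ∀ᵐ ω ∂P, ∀ j, 0 < durations t (τ ω) j :=
  ae_of_ae_map h.law_times.aemeasurable
    (by rw [h.law_times.map_eq]; exact ae_dirichletLaw_durations_pos n a t)

lemma IsFlightData.aemeasurable_position (h : IsFlightData P d n a t τ θ) :
    AEMeasurable (position c t τ θ) P := by
  have h1 : ∀ j, AEMeasurable (fun ω => durations t (τ ω) j) P := fun j =>
    (measurable_pi_iff.1 (measurable_durations t) j).comp_aemeasurable h.law_times.aemeasurable
  have h2 : ∀ j, AEMeasurable (fun ω => (θ j ω : EuclideanSpace ℝ (Fin d))) P := fun j =>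
    measurable_subtype_coe.comp_aemeasurable (h.law_directions j).aemeasurable
  exact (Finset.aemeasurable_fun_sum _ fun j _ => (h1 j).smul (h2 j)).const_smul c

lemma IsFlightData.ae_norm_position_le (h : IsFlightData P d n a t τ θ) (hc : 0 < c) :
    ∀ᵐ ω ∂P, ‖position c t τ θ ω‖ ≤ c * t := by
  filter_upwards [h.ae_durations_pos] with ω hω
  rw [position, norm_smul, Real.norm_eq_abs, abs_of_pos hc]
  gcongr
  refine (norm_sum_le _ _).trans (le_of_eq ?_)
  refine Eq.trans ?_ (sum_durations t (τ ω))
  refine Finset.sum_congr rfl fun j _ => ?_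
  rw [norm_smul, norm_eq_of_mem_sphere, mul_one, Real.norm_eq_abs, abs_of_pos (hω j)]

/-- Independence splits the mixed moments of the steps. -/
lemma IsFlightData.integral_prod_pow [IsProbabilityMeasure P]
    (h : IsFlightData P d n a t τ θ) (hd : 1 ≤ d) (ha : 0 < a) (ht : 0 < t)
    (ξ : EuclideanSpace ℝ (Fin d)) (k : Fin (n + 1) → ℕ) :
    ∫ ω, ∏ j, (durations t (τ ω) j * inner ℝ ξ (θ j ω : EuclideanSpace ℝ (Fin d))) ^ k j ∂P =
      (t * ‖ξ‖) ^ (∑ j, k j) *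
        (Real.Gamma ((n + 1) * a) / Real.Gamma ((n + 1) * a + (∑ j, k j : ℕ))) *
        ∏ j, (Real.Gamma (a + k j) / Real.Gamma a * symmMoment (d / 2) (k j)) := by
  have m1 : Measurable fun s : Fin n → ℝ => ∏ j, durations t s j ^ k j :=
    Finset.measurable_prod _ fun j _ =>
      (measurable_pi_iff.1 (measurable_durations t) j).pow_const _
  have m2 : ∀ j, Measurable fun u : Metric.sphere (0 : EuclideanSpace ℝ (Fin d)) 1 =>
      inner ℝ ξ (u : EuclideanSpace ℝ (Fin d)) ^ k j := fun j => by fun_prop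
  have m3 : Measurable fun u : Fin (n + 1) → Metric.sphere (0 : EuclideanSpace ℝ (Fin d)) 1 =>
      ∏ j, inner ℝ ξ (u j : EuclideanSpace ℝ (Fin d)) ^ k j :=
    Finset.measurable_prod _ fun j _ => (m2 j).comp (measurable_pi_apply j)
  have hθ : ∀ j, AEMeasurable (θ j) P := fun j => (h.law_directions j).aemeasurable
  simp_rw [mul_pow, Finset.prod_mul_distrib]
  have hI := (h.indep_times_directions.comp m1 m3).integral_fun_mul_eq_mul_integral
    (m1.comp_aemeasurable h.law_times.aemeasurable).aestronglyMeasurable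
    (m3.comp_aemeasurable (aemeasurable_pi_iff.2 hθ)).aestronglyMeasurable
  simp only [Function.comp_apply] at hI
  have hJ := (h.indep_directions.comp _ m2).integral_fun_prod_eq_prod_integral
    (fun j => ((m2 j).comp_aemeasurable (hθ j)).aestronglyMeasurable)
  simp only [Function.comp_apply] at hJ
  have hK : ∀ j, ∫ ω, inner ℝ ξ (θ j ω : EuclideanSpace ℝ (Fin d)) ^ k j ∂P =
      ‖ξ‖ ^ k j * symmMoment (d / 2) (k j) := fun j => by
    rw [← integral_uniformSphere_inner_pow hd]
    exact (h.law_directions j).integral_comp (m2 j).aestronglyMeasurable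
  have hT : ∫ ω, ∏ j, durations t (τ ω) j ^ k j ∂P = _ :=
    (h.law_times.integral_comp m1.aestronglyMeasurable).trans
      (integral_dirichletLaw_prod_pow n ha ht k)
  rw [hI, hJ, hT]
  simp_rw [hK]
  rw [Finset.prod_mul_distrib, Finset.prod_pow_eq_pow_sum]
  ring

lemma sum_piAntidiag_eq_coeff_pow (F : PowerSeries ℝ) (n k : ℕ) :
    ∑ l ∈ Finset.piAntidiag (Finset.univ : Finset (Fin n)) k,
      ∏ j, PowerSeries.coeff (l j) F = PowerSeries.coeff k (F ^ n) := by
  have h := PowerSeries.coeff_prod (fun _ : Fin n => F) k Finset.univ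
  rw [Finset.prod_const, Finset.card_univ, Fintype.card_fin] at h
  rw [h]
  refine Finset.sum_nbij' (fun l => Finsupp.equivFunOnFinite.symm l) (fun l => l) ?_ ?_ ?_ ?_ ?_
  · intro l hl; simpa using hl
  · intro l hl; simpa using hl
  · intro l _; rfl
  · intro l _; ext; rfl
  · intro l _; rfl

/-- The moments of the position: expanding the power of the sum turns the product of the Dirichlet
and the sphere moments into a coefficient of a power of `momentSeries`. -/
lemma IsFlightData.integral_inner_position_pow [IsProbabilityMeasure P]
    (h : IsFlightData P d n a t τ θ) (hd : 1 ≤ d)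
    (ha : 0 < a) (ht : 0 < t) (ξ : EuclideanSpace ℝ (Fin d)) (k : ℕ) :
    ∫ ω, inner ℝ ξ (position c t τ θ ω) ^ k ∂P =
      (c * t * ‖ξ‖) ^ k * (Real.Gamma ((n + 1) * a) / Real.Gamma ((n + 1) * a + k)) *
        k.factorial * PowerSeries.coeff k (momentSeries (d / 2) a ^ (n + 1)) := by
  have e : ∀ ω, inner ℝ ξ (position c t τ θ ω) ^ k = ∑ l ∈ Finset.piAntidiag Finset.univ k,
      c ^ k * (Nat.multinomial Finset.univ l : ℝ) *
      ∏ j, (durations t (τ ω) j * inner ℝ ξ (θ j ω : EuclideanSpace ℝ (Fin d))) ^ l j := by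
    intro ω
    rw [position, inner_smul_right, inner_sum, mul_pow]
    simp_rw [inner_smul_right]
    rw [Finset.sum_pow_eq_sum_piAntidiag, Finset.mul_sum]
    simp_rw [mul_assoc]
  simp_rw [e]
  have h1 : ∀ j, AEMeasurable (fun ω => durations t (τ ω) j) P := fun j =>
    (measurable_pi_iff.1 (measurable_durations t) j).comp_aemeasurable h.law_times.aemeasurable
  have h2 : ∀ j, AEMeasurable (fun ω => inner ℝ ξ (θ j ω : EuclideanSpace ℝ (Fin d))) P :=
    fun j => (by fun_prop : Measurable fun u : Metric.sphere (0 : EuclideanSpace ℝ (Fin d)) 1 =>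
      inner ℝ ξ (u : EuclideanSpace ℝ (Fin d))).comp_aemeasurable
      (h.law_directions j).aemeasurable
  have hint : ∀ l : Fin (n + 1) → ℕ, Integrable (fun ω =>
      ∏ j, (durations t (τ ω) j * inner ℝ ξ (θ j ω : EuclideanSpace ℝ (Fin d))) ^ l j) P := by
    intro l
    refine Integrable.of_bound (C := ∏ j, (t * ‖ξ‖) ^ l j)
      (Finset.aemeasurable_fun_prod _ fun j _ =>
        ((h1 j).mul (h2 j)).pow_const _).aestronglyMeasurable ?_
    filter_upwards [h.ae_durations_pos] with ω hω
    rw [norm_prod]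
    refine Finset.prod_le_prod (fun _ _ => norm_nonneg _) fun j _ => ?_
    rw [norm_pow, norm_mul, Real.norm_eq_abs, abs_of_pos (hω j)]
    have hle : durations t (τ ω) j ≤ t := by
      conv_rhs => rw [← sum_durations t (τ ω)]
      exact Finset.single_le_sum (fun i _ => (hω i).le) (Finset.mem_univ j)
    have hin : ‖inner ℝ ξ (θ j ω : EuclideanSpace ℝ (Fin d))‖ ≤ ‖ξ‖ := by
      have := norm_inner_le_norm (𝕜 := ℝ) ξ (θ j ω : EuclideanSpace ℝ (Fin d))
      rwa [norm_eq_of_mem_sphere, mul_one] at this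
    have := hω j
    gcongr
  rw [integral_finsetSum _ fun l _ => (hint l).const_mul _, ← sum_piAntidiag_eq_coeff_pow,
    Finset.mul_sum]
  refine Finset.sum_congr rfl fun l hl => ?_
  have hl : ∑ j, l j = k := by simpa using hl
  rw [integral_const_mul, h.integral_prod_pow hd ha ht, hl]
  have hmul := Nat.multinomial_spec Finset.univ l
  rw [hl] at hmul
  have hF : (∏ j, ((l j).factorial : ℝ)) ≠ 0 :=
    Finset.prod_ne_zero_iff.2 fun j _ => by positivity
  simp only [momentSeries, PowerSeries.coeff_mk]
  rw [Finset.prod_div_distrib, ← hmul]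
  push_cast
  field_simp
  ring

/-- The common form of the two families of flights: if the powers of the moment series of the
directions are again moment series, all projections have densities `ballDensity`. -/
lemma IsFlightData.hasLaw_proj_position [IsProbabilityMeasure P]
    (h : IsFlightData P d n a t τ θ) (hc : 0 < c) (ha : 0 < a)
    (ht : 0 < t) {q : ℝ} (hpow : momentSeries (d / 2) a ^ (n + 1) = momentSeries q ((n + 1) * a))
    {m : ℕ} (hm : 1 ≤ m) (hmd : m ≤ d) (hq : (m : ℝ) / 2 < q) :
    HasLaw (fun ω => proj hmd (position c t τ θ ω)) (ballLaw m q (c * t)) P := by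
  have hmeas : AEMeasurable (fun ω => proj hmd (position c t τ θ ω)) P :=
    (measurable_proj hmd).comp_aemeasurable h.aemeasurable_position
  have hR : 0 < c * t := mul_pos hc ht
  refine ⟨hmeas, ?_⟩
  have := isFiniteMeasure_ballLaw hm hq hR
  have := Measure.isFiniteMeasure_map P (fun ω => proj hmd (position c t τ θ ω))
  refine ext_of_moments (R := c * t) ?_ (ae_ballLaw_norm_le m q _) fun ξ k => ?_
  · rw [ae_map_iff hmeas (measurableSet_le (by fun_prop) (by fun_prop))]
    filter_upwards [h.ae_norm_position_le hc] with ω hω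
    exact (norm_proj_le hmd _).trans hω
  · obtain ⟨ζ, hζ, hζx⟩ := exists_inner_proj hmd ξ
    rw [integral_map hmeas (by apply Continuous.aestronglyMeasurable; fun_prop),
      integral_ballLaw_inner_pow hm hq hR]
    simp_rw [hζx]
    rw [h.integral_inner_position_pow (hm.trans hmd) ha ht, hpow, hζ, momentSeries,
      PowerSeries.coeff_mk]
    have h1 : 0 < Real.Gamma ((n + 1) * a) := Real.Gamma_pos_of_pos (by positivity)
    have h2 : 0 < Real.Gamma ((n + 1) * a + k) := Real.Gamma_pos_of_pos (by positivity)
    field_simp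

end Flight

/-! ### The Beta laws in dimension one -/

lemma lintegral_comp_affine {F : ℝ → ENNReal} (hF : Measurable F) {R : ℝ} (hR : 0 < R) :
    ∫⁻ y, F ((1 + y / R) / 2) = ENNReal.ofReal (2 * R) * ∫⁻ z, F z := by
  have h1 : ∫⁻ z, F z = ∫⁻ z, F (1 / 2 + z) := (lintegral_add_left_eq_self F (1 / 2)).symm
  have h2 := Real.map_volume_mul_left (a := 1 / (2 * R)) (by positivity)
  have h3 : ∫⁻ y, F (1 / 2 + 1 / (2 * R) * y) =
      ∫⁻ z, F (1 / 2 + z) ∂(Measure.map (1 / (2 * R) * ·) volume) := by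
    rw [lintegral_map (by fun_prop) (by fun_prop)]
  rw [h2, lintegral_smul_measure, ← h1, one_div (2 * R), inv_inv, abs_of_pos (by positivity),
    smul_eq_mul] at h3
  rw [← h3]
  congr 1; ext y; congr 1; field_simp

/-- In dimension one the ball density is a rescaled symmetric Beta density; the constants agree by
the duplication formula for the Gamma function. -/
lemma ballDensity_one_eq {q R : ℝ} (hq : 1 / 2 < q) (hR : 0 < R)
    (x : EuclideanSpace ℝ (Fin 1)) :
    ballDensity 1 q R x =
      1 / (2 * R) * betaPDFReal (q - 1 / 2) (q - 1 / 2) ((1 + x 0 / R) / 2) := by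
  have hx : ‖x‖ = |x 0| := by
    rw [EuclideanSpace.norm_eq, Fin.sum_univ_one, Real.sqrt_sq (norm_nonneg _), Real.norm_eq_abs]
  have hiff : ‖x‖ < R ↔ 0 < (1 + x 0 / R) / 2 ∧ (1 + x 0 / R) / 2 < 1 := by
    rw [hx, abs_lt]
    constructor
    · rintro ⟨h1, h2⟩
      have h3 : -1 < x 0 / R := by rw [lt_div_iff₀ hR]; linarith
      have h4 : x 0 / R < 1 := by rw [div_lt_iff₀ hR]; linarith
      constructor <;> linarith
    · rintro ⟨h1, h2⟩
      have h3 : -1 < x 0 / R := by linarith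
      have h4 : x 0 / R < 1 := by linarith
      rw [lt_div_iff₀ hR] at h3
      rw [div_lt_iff₀ hR] at h4
      constructor <;> linarith
  unfold ballDensity betaPDFReal
  by_cases h : ‖x‖ < R
  · rw [if_pos h, if_pos (hiff.1 h)]
    obtain ⟨hz0, hz1⟩ := hiff.1 h
    have hpos : 0 < R ^ 2 - ‖x‖ ^ 2 := by
      have := (sq_lt_sq₀ (norm_nonneg x) hR.le).2 h
      linarith
    have hprod : (1 + x 0 / R) / 2 * (1 - (1 + x 0 / R) / 2) = (R ^ 2 - ‖x‖ ^ 2) / (2 * R) ^ 2 := by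
      rw [hx, sq_abs]; field_simp; ring
    rw [mul_assoc (1 / beta _ _), ← Real.mul_rpow hz0.le (by linarith), hprod,
      Real.div_rpow hpos.le (by positivity), beta]
    have hdup := Real.Gamma_mul_Gamma_add_half (q - 1 / 2)
    rw [sub_add_cancel] at hdup
    have hG : 0 < Real.Gamma (q - 1 / 2) := Real.Gamma_pos_of_pos (by linarith)
    have e1 : ((2 * R) ^ 2) ^ (q - 1 / 2 - 1) = (2 : ℝ) ^ (2 * q - 3) * (R ^ (2 * q - 2) / R) := by
      rw [← Real.rpow_natCast (2 * R) 2, ← Real.rpow_mul (by positivity),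
        Real.mul_rpow two_pos.le hR.le]
      have : R ^ (2 * q - 2) / R = R ^ (2 * q - 3) := by
        nth_rewrite 2 [← Real.rpow_one R]
        rw [← Real.rpow_sub hR]; congr 1; ring
      rw [this]
      congr 2 <;> push_cast <;> ring
    have e2 : (2 : ℝ) ^ (1 - 2 * (q - 1 / 2)) = 1 / (2 * 2 ^ (2 * q - 3)) := by
      rw [show 1 - 2 * (q - 1 / 2) = -(1 + (2 * q - 3)) by ring, Real.rpow_neg two_pos.le,
        Real.rpow_add two_pos, Real.rpow_one, one_div]
    have e3 : q - 1 / 2 + (q - 1 / 2) = 2 * (q - 1 / 2) := by ring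
    have e4 : Real.pi ^ (((1 : ℕ) : ℝ) / 2) = √Real.pi := by
      rw [Real.sqrt_eq_rpow]; norm_num
    rw [e2] at hdup
    rw [e1, e3, e4, Nat.cast_one]
    have hR' : 0 < R ^ (2 * q - 2) := by positivity
    have h2 : (0 : ℝ) < 2 ^ (2 * q - 3) := by positivity
    have hs : 0 < √Real.pi := Real.sqrt_pos.2 Real.pi_pos
    have hG2 : 0 < Real.Gamma (2 * (q - 1 / 2)) := Real.Gamma_pos_of_pos (by linarith)
    have hdup' : Real.Gamma q = Real.Gamma (2 * (q - 1 / 2)) *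
        (1 / (2 * 2 ^ (2 * q - 3))) * √Real.pi / Real.Gamma (q - 1 / 2) := by
      rw [eq_div_iff hG.ne', ← hdup]; ring
    rw [hdup']
    generalize Real.Gamma (2 * (q - 1 / 2)) = G2 at *
    generalize Real.Gamma (q - 1 / 2) = G1 at *
    generalize (R ^ 2 - ‖x‖ ^ 2) ^ (q - 1 / 2 - 1) = B at *
    field_simp
  · rw [if_neg h, if_neg fun h' => h (hiff.2 h'), mul_zero]

lemma hasLaw_betaMeasure_of_ballLaw {q R : ℝ} (hq : 1 / 2 < q) (hR : 0 < R) :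
    HasLaw (fun x : EuclideanSpace ℝ (Fin 1) => ((1 + x 0 / R) / 2 : ℝ))
      (betaMeasure (q - 1 / 2) (q - 1 / 2)) (ballLaw 1 q R) := by
  have hg : Measurable fun x : EuclideanSpace ℝ (Fin 1) => ((1 + x 0 / R) / 2 : ℝ) := by fun_prop
  have hb : Measurable (betaPDF (q - 1 / 2) (q - 1 / 2)) :=
    (measurable_betaPDFReal _ _).ennreal_ofReal
  refine ⟨hg.aemeasurable, Measure.ext fun (S : Set ℝ) hS => ?_⟩
  have hF : Measurable (S.indicator (betaPDF (q - 1 / 2) (q - 1 / 2))) := hb.indicator hS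
  rw [Measure.map_apply hg hS, withDensity_apply _ (hg hS), betaMeasure, withDensity_apply _ hS,
    ← lintegral_indicator (hg hS), ← lintegral_indicator hS]
  have e : ∀ x : EuclideanSpace ℝ (Fin 1),
      ((fun x : EuclideanSpace ℝ (Fin 1) => ((1 + x 0 / R) / 2 : ℝ)) ⁻¹' S).indicator
        (fun x => ENNReal.ofReal (ballDensity 1 q R x)) x =
      ENNReal.ofReal (1 / (2 * R)) *
        S.indicator (betaPDF (q - 1 / 2) (q - 1 / 2)) ((1 + x 0 / R) / 2) := by
    intro x
    by_cases hx : (1 + x 0 / R) / 2 ∈ S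
    · rw [Set.indicator_of_mem hx, Set.indicator_of_mem (by exact hx), ballDensity_one_eq hq hR,
        ENNReal.ofReal_mul (by positivity)]
      rfl
    · rw [Set.indicator_of_notMem hx, Set.indicator_of_notMem (by exact hx), mul_zero]
  have hmp : MeasurePreserving (fun x : EuclideanSpace ℝ (Fin 1) => x 0) :=
    (volume_preserving_funUnique (Fin 1) ℝ).comp
      (EuclideanSpace.volume_preserving_symm_measurableEquiv_toLp (Fin 1))
  simp_rw [e]
  rw [lintegral_const_mul' _ _ ENNReal.ofReal_ne_top,
    hmp.lintegral_comp (f := fun y => S.indicator (betaPDF (q - 1 / 2) (q - 1 / 2))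
      ((1 + y / R) / 2)) (hF.comp (by fun_prop)), lintegral_comp_affine hF hR, ← mul_assoc,
    ← ENNReal.ofReal_mul (by positivity), one_div_mul_cancel (by positivity), ENNReal.ofReal_one,
    one_mul]

/-! ### The densities of the two families -/

lemma margX_eq_ballDensity (d n m : ℕ) (c t : ℝ) :
    margX d n m c t = ballDensity m (((n : ℝ) + 1) / 2 * (d - 1) + 1 / 2) (c * t) := by
  have e1 : ((n : ℝ) + 1) / 2 * (d - 1) + (1 - m) / 2 =
      ((n : ℝ) + 1) / 2 * (d - 1) + 1 / 2 - m / 2 := by ring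
  have e2 : ((n : ℝ) + 1) / 2 * (d - 1) - (m + 1) / 2 =
      ((n : ℝ) + 1) / 2 * (d - 1) + 1 / 2 - m / 2 - 1 := by ring
  have e3 : ((n : ℝ) + 1) * (d - 1) - 1 = 2 * (((n : ℝ) + 1) / 2 * (d - 1) + 1 / 2) - 2 := by ring
  ext x
  simp only [margX, ballDensity, mul_pow c t 2, e1, e2, e3]

lemma margY_eq_ballDensity (d n m : ℕ) (c t : ℝ) :
    margY d n m c t = ballDensity m (((n : ℝ) + 1) * (d / 2 - 1) + 1) (c * t) := by
  have e1 : ((n : ℝ) + 1) * (d / 2 - 1) - m / 2 =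
      ((n : ℝ) + 1) * (d / 2 - 1) + 1 - m / 2 - 1 := by ring
  have e2 : 2 * ((n : ℝ) + 1) * (d / 2 - 1) = 2 * (((n : ℝ) + 1) * (d / 2 - 1) + 1) - 2 := by ring
  ext y
  simp only [margY, ballDensity, mul_pow c t 2, e1, e2]

lemma margX_self_eq_fullX (d n : ℕ) (c t : ℝ) : margX d n d c t = fullX d n c t := by
  have e1 : ((n : ℝ) + 1) / 2 * (d - 1) + (1 - d) / 2 = n / 2 * (d - 1) := by ring
  have e2 : ((n : ℝ) + 1) / 2 * (d - 1) - (d + 1) / 2 = n / 2 * (d - 1) - 1 := by ring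
  ext x
  simp only [margX, fullX, e1, e2]

lemma margY_self_eq_fullY (d n : ℕ) (c t : ℝ) : margY d n d c t = fullY d n c t := by
  have e1 : ((n : ℝ) + 1) * (d / 2 - 1) + 1 - d / 2 = n * (d / 2 - 1) := by ring
  have e2 : ((n : ℝ) + 1) * (d / 2 - 1) - d / 2 = n * (d / 2 - 1) - 1 := by ring
  ext y
  simp only [margY, fullY, e1, e2]

end RandomFlight

end

open RandomFlight in
theorem theorem4 {Ω : Type*} [MeasurableSpace Ω] (P : Measure Ω) [IsProbabilityMeasure P]
    (d n : ℕ) (hn : 1 ≤ n) (c t : ℝ) (hc : 0 < c) (ht : 0 < t)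
    (τ : Ω → Fin n → ℝ)
    (θ : Fin (n + 1) → Ω → Metric.sphere (0 : EuclideanSpace ℝ (Fin d)) 1) :
    (2 ≤ d → RandomFlight.IsFlightData P d n ((d : ℝ) - 1) t τ θ →
      (∀ (m : ℕ) (h : m ≤ d), 1 ≤ m →
        HasLaw (fun ω => RandomFlight.proj h (RandomFlight.position c t τ θ ω))
          ((volume : Measure (EuclideanSpace ℝ (Fin m))).withDensity
            fun x => ENNReal.ofReal (RandomFlight.margX d n m c t x)) P) ∧
      (∀ x : EuclideanSpace ℝ (Fin d),
        RandomFlight.margX d n d c t x = RandomFlight.fullX d n c t x) ∧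
      HasLaw (RandomFlight.position c t τ θ)
        ((volume : Measure (EuclideanSpace ℝ (Fin d))).withDensity
          fun x => ENNReal.ofReal (RandomFlight.fullX d n c t x)) P ∧
      (∀ h : 0 < d,
        HasLaw (fun ω => (1 + RandomFlight.position c t τ θ ω ⟨0, h⟩ / (c * t)) / 2)
          (betaMeasure (((n : ℝ) + 1) / 2 * (d - 1)) (((n : ℝ) + 1) / 2 * (d - 1))) P)) ∧
    (3 ≤ d → RandomFlight.IsFlightData P d n ((d : ℝ) / 2 - 1) t τ θ →
      (∀ (m : ℕ) (h : m ≤ d), 1 ≤ m →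
        HasLaw (fun ω => RandomFlight.proj h (RandomFlight.position c t τ θ ω))
          ((volume : Measure (EuclideanSpace ℝ (Fin m))).withDensity
            fun y => ENNReal.ofReal (RandomFlight.margY d n m c t y)) P) ∧
      (∀ y : EuclideanSpace ℝ (Fin d),
        RandomFlight.margY d n d c t y = RandomFlight.fullY d n c t y) ∧
      HasLaw (RandomFlight.position c t τ θ)
        ((volume : Measure (EuclideanSpace ℝ (Fin d))).withDensity
          fun y => ENNReal.ofReal (RandomFlight.fullY d n c t y)) P ∧
      (∀ h : 0 < d,
        HasLaw (fun ω => (1 + RandomFlight.position c t τ θ ω ⟨0, h⟩ / (c * t)) / 2)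
          (betaMeasure (((n : ℝ) + 1) * (d / 2 - 1) + 1 / 2)
            (((n : ℝ) + 1) * (d / 2 - 1) + 1 / 2)) P)) := by


  refine ⟨fun hd h => ?_, fun hd h => ?_⟩
  · have hn' : (1 : ℝ) ≤ n := by exact_mod_cast hn
    have hd' : (2 : ℝ) ≤ d := by exact_mod_cast hd
    have ha : (0 : ℝ) < (d : ℝ) - 1 := by linarith
    have hpow : momentSeries (d / 2) ((d : ℝ) - 1) ^ (n + 1) =
        momentSeries (((n : ℝ) + 1) / 2 * (d - 1) + 1 / 2) ((n + 1) * ((d : ℝ) - 1)) := by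
      have := momentSeries_half_pow n ha
      rw [sub_add_cancel] at this
      rw [this]; congr 1; ring
    have hlaw : ∀ (m : ℕ) (hmd : m ≤ d), 1 ≤ m →
        HasLaw (fun ω => proj hmd (position c t τ θ ω))
          (ballLaw m (((n : ℝ) + 1) / 2 * (d - 1) + 1 / 2) (c * t)) P := fun m hmd hm => by
      have hmd' : (m : ℝ) ≤ d := by exact_mod_cast hmd
      exact h.hasLaw_proj_position hc ha ht hpow hm hmd (by nlinarith)
    refine ⟨fun m hmd hm => ?_, fun x => by rw [margX_self_eq_fullX], ?_, fun h0 => ?_⟩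
    · rw [margX_eq_ballDensity]
      exact hlaw m hmd hm
    · rw [← margX_self_eq_fullX, margX_eq_ballDensity]
      exact hlaw d le_rfl (by omega)
    · have := (hasLaw_betaMeasure_of_ballLaw (q := ((n : ℝ) + 1) / 2 * (d - 1) + 1 / 2)
        (R := c * t) (by have : 0 < ((n : ℝ) + 1) / 2 * (d - 1) := by positivity
                         linarith) (by positivity)).fun_comp (hlaw 1 h0 le_rfl)
      rw [add_sub_cancel_right] at this
      exact this
  · have hn' : (1 : ℝ) ≤ n := by exact_mod_cast hn
    have hd' : (3 : ℝ) ≤ d := by exact_mod_cast hd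
    have ha : (0 : ℝ) < (d : ℝ) / 2 - 1 := by linarith
    have hpow : momentSeries (d / 2) ((d : ℝ) / 2 - 1) ^ (n + 1) =
        momentSeries (((n : ℝ) + 1) * (d / 2 - 1) + 1) ((n + 1) * ((d : ℝ) / 2 - 1)) := by
      have := momentSeries_add_one_pow n ha
      rwa [sub_add_cancel] at this
    have hlaw : ∀ (m : ℕ) (hmd : m ≤ d), 1 ≤ m →
        HasLaw (fun ω => proj hmd (position c t τ θ ω))
          (ballLaw m (((n : ℝ) + 1) * (d / 2 - 1) + 1) (c * t)) P := fun m hmd hm => by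
      have hmd' : (m : ℝ) ≤ d := by exact_mod_cast hmd
      exact h.hasLaw_proj_position hc ha ht hpow hm hmd (by nlinarith)
    refine ⟨fun m hmd hm => ?_, fun x => by rw [margY_self_eq_fullY], ?_, fun h0 => ?_⟩
    · rw [margY_eq_ballDensity]
      exact hlaw m hmd hm
    · rw [← margY_self_eq_fullY, margY_eq_ballDensity]
      exact hlaw d le_rfl (by omega)
    · have := (hasLaw_betaMeasure_of_ballLaw (q := ((n : ℝ) + 1) * (d / 2 - 1) + 1)
        (R := c * t) (by have : 0 < ((n : ℝ) + 1) * (d / 2 - 1) := by positivity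
                         linarith) (by positivity)).fun_comp (hlaw 1 h0 le_rfl)
      rw [show ((n : ℝ) + 1) * (d / 2 - 1) + 1 - 1 / 2 =
        ((n : ℝ) + 1) * (d / 2 - 1) + 1 / 2 by ring] at this
      exact this
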